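/- Let $a_n>0$ and $b_n\in\mathbb R$ $(n=0,1,2,\dots)$ satisfy $$\lim_{n\to\infty}\bigl(a_n-\tfrac12\bigr)=\lim_{n\to\infty}b_n=0,\qquad \sum_{n=0}^\infty\bigl(|a_{n+1}-a_n|+|b_{n+1}-b_n|\bigr)<\infty ,$$ and put $a_{-1}=\frac12$. Let $J$ be the bounded self-adjoint operator in $\ell^2(\mathbb Z_+)$, with canonical basis $e_0,e_1,\dots$, given by the Jacobi matrix with diagonal entries $b_n$ and off-diagonal entries $a_n$, and let $R(z)=(J-z)^{-1}$. Scalar products are linear in the first argument. Notation. Consider the Jacobi equation $$a_{n-1}f_{n-1}+b_nf_n+a_nf_{n+1}=zf_n,\qquad n=0,1,2,\dots,\tag{1}$$ for sequences $(f_n)_{n\ge-1}$. Let $P_n(z)$ be its solution with $P_{-1}=0$, $P_0=1$. The plane is cut along $\mathbb R$: below, $z$ is a point of the closed upper or of the closed lower half-plane, the two edges of the cut being distinguished (real points are $\lambda+i0$ or $\lambda-i0$). Let $\zeta(w)=w-\sqrt{w^2-1}$, where $\sqrt{w^2-1}$ is analytic on $\mathbb C\setminus[-1,1]$, positive for $w>1$,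 and $\sqrt{w^2-1}=\pm i\sqrt{1-\lambda^2}$ at $w=\lambda\pm i0$, $\lambda\in[-1,1]$. Put $$q_n(z)=\prod_{k=0}^{n-1}\zeta\Bigl(\frac{z-b_k}{2a_k}\Bigr).$$ For $z\ne\pm1$, equation (1) has exactly one solution $f_n(z)$ (the Jost solution) with $f_n(z)=q_n(z)(1+o(1))$ as $n\to\infty$. Let $\Omega(z)=a_n\bigl(P_n(z)f_{n+1}(z)-P_{n+1}(z)f_n(z)\bigr)$, which does not depend on $n\ge-1$, so that $\Omega(z)=-\frac12f_{-1}(z)$. Call $z$ (with its edge, if real) *regular* if $z\neq\pm1$ and $z$ is not an eigenvalue of $J$ lying in $\mathbb C\setminus[-1,1]$. For $\lambda\in(-1,1)$, $(R(\lambda\pm i0)e_n,e_m)$ denotes the limit of $(R(w)e_n,e_m)$ as $w\to\lambda$, $\pm\operatorname{Im}w>0$. Theorem. (i) If $z\in\mathbb C\setminus[-1,1]$ is not an eigenvalue of $J$, then $J-z$ is boundedly invertible and $(R(z)u)_m=\sum_{n}(R(z)e_n,e_m)u_n$ for all $u\in\ell^2(\mathbb Z_+)$ and all $m$. For all regular $z$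 (including $z=\lambda\pm i0$, $\lambda\in(-1,1)$) one has $\Omega(z)\ne0$ and $$(R(z)e_n,e_m)=(R(z)e_m,e_n)=\Omega(z)^{-1}P_n(z)f_m(z),\qquad 0\le n\le m .$$ For all $n,m\ge 0$ the function $(R(z)e_n,e_m)$ is analytic on $\mathbb C\setminus[-1,1]$ except at the eigenvalues of $J$. At an eigenvalue $z\in\mathbb C\setminus[-1,1]$ its singularity is at most a simple pole, and it is a simple pole if and only if $P_n(z)P_m(z)\ne0$ (in particular, if $n=m=0$). A point $z\in\mathbb C\setminus[-1,1]$ is an eigenvalue of $J$ if and only if $\Omega(z)=0$ (on either edge, if $z$ is real). (ii) For all $n,m\ge 0$, the function $(R(z)e_n,e_m)$, extended to the edges $\lambda\pm i0$, $\lambda\in(-1,1)$, by its limits, is continuous on the set of regular points of the closed upper half-plane and on that of the closed lower half-plane (limiting absorption principle). (iii) Let $K$ be a compact subset of the closed upper, or of the closed lower, half-plane with $\pm1\notin K$. There is a constant $C>0$, independent of $n$, $m$ and $z$, such that $$|(R(z)e_n,e_m)|\le C\,|\Omega(z)|^{-1}\,\bigl|q_m(z)/q_n(z)\bigr|,\qquad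 0\le n\le m,$$ for all regular $z\in K$. If moreover $K$ consists of regular points, then there is a constant $C_1<\infty$, independent of $n$, $m$ and $z$, such that $C|\Omega(z)|^{-1}|q_m(z)/q_n(z)|\le C_1$ for all $z\in K$ and $0\le n\le m$. -/

import Mathlib

open Filter Topology Set
open scoped ComplexConjugate

namespace LongRangeJacobi

/-! ### The Jacobi operator in `ℓ²(ℤ₊)` -/

/-- The Hilbert space `ℓ²(ℤ₊)` of square summable complex sequences. -/
abbrev Ell2 : Type := lp (fun _ : ℕ => ℂ) 2

theorem memlp_weightedShift {w : ℕ → ℂ} {C : ℝ} (hC : ∀ n, ‖w n‖ ≤ C) (k : ℕ) (u : Ell2) :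
    Memℓp (fun n => w n * u (n + k)) 2 := by
  have hu : Summable fun n => ‖u n‖ ^ (2 : ℝ) := by
    simpa using (lp.memℓp u).summable (by norm_num)
  have hs : Summable fun n => ‖u (n + k)‖ ^ (2 : ℝ) :=
    (summable_nat_add_iff (f := fun n => ‖u n‖ ^ (2 : ℝ)) k).2 hu
  refine memℓp_gen ?_
  simp only [ENNReal.toReal_ofNat]
  refine Summable.of_nonneg_of_le (fun n => by positivity) (fun n => ?_) (hs.mul_left (C ^ (2 : ℝ)))
  have h0 : 0 ≤ C := (norm_nonneg _).trans (hC n)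
  rw [norm_mul, Real.mul_rpow (norm_nonneg _) (norm_nonneg _)]
  gcongr
  exact hC n

theorem norm_weightedShift_le {w : ℕ → ℂ} {C : ℝ} (hC : ∀ n, ‖w n‖ ≤ C) (k : ℕ) (u : Ell2) :
    ‖(⟨fun n => w n * u (n + k), memlp_weightedShift hC k u⟩ : Ell2)‖ ≤ C * ‖u‖ := by
  have h0 : 0 ≤ C := (norm_nonneg _).trans (hC 0)
  have hu : Summable fun n => ‖u n‖ ^ (2 : ℝ) := by
    simpa using (lp.memℓp u).summable (by norm_num)
  refine lp.norm_le_of_forall_sum_le (by norm_num) (by positivity) (fun t => ?_)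
  have key : ∑ i ∈ t, ‖u (i + k)‖ ^ (2 : ℝ) ≤ ‖u‖ ^ (2 : ℝ) := by
    have h2 := lp.sum_rpow_le_norm_rpow (p := 2) (by norm_num) u (t.map (addRightEmbedding k))
    simpa using h2
  simp only [ENNReal.toReal_ofNat]
  rw [Real.mul_rpow h0 (norm_nonneg _)]
  calc ∑ i ∈ t, ‖w i * u (i + k)‖ ^ (2 : ℝ)
      ≤ ∑ i ∈ t, C ^ (2 : ℝ) * ‖u (i + k)‖ ^ (2 : ℝ) := by
        refine Finset.sum_le_sum fun i _ => ?_
        rw [norm_mul, Real.mul_rpow (norm_nonneg _) (norm_nonneg _)]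
        gcongr
        exact hC i
    _ = C ^ (2 : ℝ) * ∑ i ∈ t, ‖u (i + k)‖ ^ (2 : ℝ) := by rw [Finset.mul_sum]
    _ ≤ C ^ (2 : ℝ) * ‖u‖ ^ (2 : ℝ) := by gcongr

open Classical in
/-- For a bounded sequence `w`, the bounded operator `(u_n) ↦ (w_n u_{n+k})` in `ℓ²(ℤ₊)`
(and the zero operator if `w` is unbounded). -/
noncomputable def weightedShift (w : ℕ → ℂ) (k : ℕ) : Ell2 →L[ℂ] Ell2 :=
  if h : ∃ C : ℝ, ∀ n, ‖w n‖ ≤ C then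
    LinearMap.mkContinuous
      { toFun := fun u => ⟨fun n => w n * u (n + k), memlp_weightedShift h.choose_spec k u⟩
        map_add' := fun u v => by ext n; simp only [lp.coeFn_add, Pi.add_apply, mul_add]
        map_smul' := fun c u => by ext n; simp [mul_left_comm] }
      h.choose (fun u => norm_weightedShift_le h.choose_spec k u)
  else 0

theorem weightedShift_apply {w : ℕ → ℂ} (h : ∃ C : ℝ, ∀ n, ‖w n‖ ≤ C) (k : ℕ) (u : Ell2) (n : ℕ) :
    weightedShift w k u n = w n * u (n + k) := by
  unfold weightedShift
  rw [dif_pos h]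
  rfl

/-- The canonical basis `e_n` of `ℓ²(ℤ₊)`. -/
noncomputable def e (n : ℕ) : Ell2 := lp.single 2 n (1 : ℂ)

/-- The off-diagonal coefficient preceding `a_n`: it is `a_{n-1}` for `n ≥ 1`,
and `a_{-1} = 1/2` for `n = 0`. -/
noncomputable def aPrev (a : ℕ → ℝ) : ℕ → ℝ
  | 0 => 1 / 2
  | n + 1 => a n

/-- The Jacobi operator `J` in `ℓ²(ℤ₊)` with diagonal entries `b_n` and off-diagonal entries `a_n`
(for bounded sequences): the operator `(u_n) ↦ (a_n u_{n+1})`, plus its adjoint, plus the diagonal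
operator. The action on coordinates is given in `jacobiOp_apply_zero`, `jacobiOp_apply_succ`. -/
noncomputable def jacobiOp (a b : ℕ → ℝ) : Ell2 →L[ℂ] Ell2 :=
  weightedShift (fun n => (a n : ℂ)) 1
    + ContinuousLinearMap.adjoint (weightedShift (fun n => (a n : ℂ)) 1)
    + weightedShift (fun n => (b n : ℂ)) 0

theorem inner_e (n : ℕ) (u : Ell2) : inner ℂ (e n) u = u n := by
  simp [e, lp.inner_single_left]

theorem adjoint_weightedShift_apply (w : ℕ → ℂ) (k n : ℕ) (u : Ell2) :
    ContinuousLinearMap.adjoint (weightedShift w k) u n = inner ℂ (weightedShift w k (e n)) u := by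
  rw [← inner_e, ContinuousLinearMap.adjoint_inner_right]

theorem weightedShift_one_e_zero {w : ℕ → ℂ} (h : ∃ C : ℝ, ∀ n, ‖w n‖ ≤ C) :
    weightedShift w 1 (e 0) = 0 := by
  ext n
  rw [weightedShift_apply h]
  simp [e, lp.single_apply]

theorem weightedShift_one_e_succ {w : ℕ → ℂ} (h : ∃ C : ℝ, ∀ n, ‖w n‖ ≤ C) (m : ℕ) :
    weightedShift w 1 (e (m + 1)) = w m • e m := by
  ext n
  rw [weightedShift_apply h]
  by_cases hn : n = m
  · subst hn; simp [e]
  · simp [e, lp.single_apply, hn]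

/-- First row of the Jacobi matrix. -/
theorem jacobiOp_apply_zero {a b : ℕ → ℝ} (ha : ∃ C : ℝ, ∀ n, |a n| ≤ C)
    (hb : ∃ C : ℝ, ∀ n, |b n| ≤ C) (u : Ell2) :
    jacobiOp a b u 0 = b 0 * u 0 + a 0 * u 1 := by
  have ha' : ∃ C : ℝ, ∀ n, ‖(a n : ℂ)‖ ≤ C := by simpa using ha
  have hb' : ∃ C : ℝ, ∀ n, ‖(b n : ℂ)‖ ≤ C := by simpa using hb
  have h : jacobiOp a b u 0 = weightedShift (fun n => (a n : ℂ)) 1 u 0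
      + ContinuousLinearMap.adjoint (weightedShift (fun n => (a n : ℂ)) 1) u 0
      + weightedShift (fun n => (b n : ℂ)) 0 u 0 := rfl
  rw [h, adjoint_weightedShift_apply, weightedShift_one_e_zero ha', weightedShift_apply ha',
    weightedShift_apply hb']
  simp [add_comm]

/-- The remaining rows of the Jacobi matrix. -/
theorem jacobiOp_apply_succ {a b : ℕ → ℝ} (ha : ∃ C : ℝ, ∀ n, |a n| ≤ C)
    (hb : ∃ C : ℝ, ∀ n, |b n| ≤ C) (u : Ell2) (n : ℕ) :
    jacobiOp a b u (n + 1) = a n * u n + b (n + 1) * u (n + 1) + a (n + 1) * u (n + 2) := by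
  have ha' : ∃ C : ℝ, ∀ n, ‖(a n : ℂ)‖ ≤ C := by simpa using ha
  have hb' : ∃ C : ℝ, ∀ n, ‖(b n : ℂ)‖ ≤ C := by simpa using hb
  have h : jacobiOp a b u (n + 1) = weightedShift (fun n => (a n : ℂ)) 1 u (n + 1)
      + ContinuousLinearMap.adjoint (weightedShift (fun n => (a n : ℂ)) 1) u (n + 1)
      + weightedShift (fun n => (b n : ℂ)) 0 u (n + 1) := rfl
  rw [h, adjoint_weightedShift_apply, weightedShift_one_e_succ ha', weightedShift_apply ha',
    weightedShift_apply hb', inner_smul_left, inner_e]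
  simp
  ring

/-- `z` is an eigenvalue of the Jacobi operator. -/
def IsEigenvalue (a b : ℕ → ℝ) (z : ℂ) : Prop :=
  Module.End.HasEigenvalue (jacobiOp a b : Ell2 →ₗ[ℂ] Ell2) z

/-- The resolvent `R(z) = (J - z)⁻¹` (zero if `J - z` is not invertible). -/
noncomputable def R (a b : ℕ → ℝ) (z : ℂ) : Ell2 →L[ℂ] Ell2 :=
  Ring.inverse (jacobiOp a b - z • (1 : Ell2 →L[ℂ] Ell2))

/-- The matrix element `(R(z) e_n, e_m)`, for a scalar product that is linear in its first
argument (Mathlib's is linear in the second one). -/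
noncomputable def entry (a b : ℕ → ℝ) (n m : ℕ) (z : ℂ) : ℂ :=
  inner ℂ (e m) (R a b z (e n))

/-! ### The plane with two edges of the real axis -/

/-- The upper side (points `z` with `Im z > 0` and boundary points `λ + i0`) and the lower side
(points `z` with `Im z < 0` and boundary points `λ - i0`). A point of the complex plane cut along
the real axis, with its two edges, is a side `s` together with a point of `s.closedHalf`. -/
inductive Side : Type
  | upper
  | lower

/-- The open half-plane of a side. -/
def Side.openHalf : Side → Set ℂ
  | .upper => {z | 0 < z.im}
  | .lower => {z | z.im < 0}

/-- The closed half-plane of a side. -/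
def Side.closedHalf : Side → Set ℂ
  | .upper => {z | 0 ≤ z.im}
  | .lower => {z | z.im ≤ 0}

/-- The interval `[-1, 1]` as a subset of the complex plane. -/
def cut : Set ℂ := (fun x : ℝ => (x : ℂ)) '' Icc (-1) 1

open Classical in
/-- The matrix element `(R(z) e_n, e_m)`, where for `z = λ ± i0` on an edge of the cut `[-1, 1]`
it is the limit from the corresponding half-plane. -/
noncomputable def edgeEntry (a b : ℕ → ℝ) (s : Side) (n m : ℕ) (z : ℂ) : ℂ :=
  if z ∈ cut then limUnder (𝓝[s.openHalf] z) (entry a b n m) else entry a b n m z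

/-- The points of a closed half-plane, except `1`, `-1` and the eigenvalues of `J`
outside `[-1, 1]`. -/
def regularSet (a b : ℕ → ℝ) (s : Side) : Set ℂ :=
  {z | z ∈ s.closedHalf ∧ z ≠ 1 ∧ z ≠ -1 ∧ (z ∉ cut → ¬ IsEigenvalue a b z)}

/-- The branch of `√(w² - 1)`, analytic outside `[-1, 1]` and positive for `w > 1`. On the upper
side it is a product of principal roots, which are continuous on the closed upper half-plane, so
that it is `i √(1 - λ²)` at `λ + i0`, `λ ∈ (-1, 1)`. The lower side is obtained by conjugation. -/
noncomputable def sqrtEdge : Side → ℂ → ℂ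
  | .upper, w => (w - 1) ^ (1 / 2 : ℂ) * (w + 1) ^ (1 / 2 : ℂ)
  | .lower, w => conj ((conj w - 1) ^ (1 / 2 : ℂ) * (conj w + 1) ^ (1 / 2 : ℂ))

/-- The function `ζ(w) = w - √(w² - 1)`, including its values on the edges. -/
noncomputable def zeta (s : Side) (w : ℂ) : ℂ := w - sqrtEdge s w

/-- The Ansatz `q_n(z) = ζ(z_0) ⋯ ζ(z_{n-1})` with `z_k = (z - b_k) / (2 a_k)`. -/
noncomputable def q (a b : ℕ → ℝ) (s : Side) (n : ℕ) (z : ℂ) : ℂ :=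
  ∏ k ∈ Finset.range n, zeta s ((z - b k) / (2 * a k))

/-! ### Solutions of the Jacobi equation

A sequence `{f_n}`, `n = -1, 0, 1, …`, is coded by `F : ℕ → ℂ` with `F (n + 1) = f_n`. -/

/-- The equation `a_{n-1} f_{n-1} + b_n f_n + a_n f_{n+1} = z f_n`, `n = 0, 1, 2, …`. -/
def SolvesJacobi (a b : ℕ → ℝ) (z : ℂ) (F : ℕ → ℂ) : Prop :=
  ∀ n : ℕ, aPrev a n * F n + b n * F (n + 1) + a n * F (n + 2) = z * F (n + 1)

/-- The Wronskian `a_n (f_n g_{n+1} - f_{n+1} g_n)`, with the index `n` shifted by one. -/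
noncomputable def wronskian (a : ℕ → ℝ) (F G : ℕ → ℂ) (n : ℕ) : ℂ :=
  aPrev a n * (F n * G (n + 1) - F (n + 1) * G n)

/-- The Wronskian of two solutions does not depend on `n`. -/
theorem wronskian_eq {a b : ℕ → ℝ} {z : ℂ} {F G : ℕ → ℂ} (hF : SolvesJacobi a b z F)
    (hG : SolvesJacobi a b z G) (n : ℕ) : wronskian a F G n = wronskian a F G 0 := by
  induction n with
  | zero => rfl
  | succ n ih =>
    rw [← ih]
    have h1 := hF n
    have h2 := hG n
    simp only [wronskian, aPrev] at *
    linear_combination F (n + 1) * h2 - G (n + 1) * h1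

/-- The polynomial solution `{P_n(z)}`, `P_{-1} = 0`, `P_0 = 1`, with the index shifted by one. -/
noncomputable def polySeq (a b : ℕ → ℝ) (z : ℂ) : ℕ → ℂ
  | 0 => 0
  | 1 => 1
  | n + 2 => ((z - b n) * polySeq a b z (n + 1) - aPrev a n * polySeq a b z n) / a n

theorem polySeq_solves {a b : ℕ → ℝ} (ha : ∀ n, 0 < a n) (z : ℂ) :
    SolvesJacobi a b z (polySeq a b z) := by
  intro n
  have h : (a n : ℂ) ≠ 0 := by exact_mod_cast (ha n).ne'
  rw [polySeq]
  field_simp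
  ring

/-- The orthonormal polynomial `P_n(z)`. -/
noncomputable def P (a b : ℕ → ℝ) (n : ℕ) (z : ℂ) : ℂ := polySeq a b z (n + 1)

/-- `F` codes the Jost solution at `z`: it solves the Jacobi equation
and `f_n = q_n(z) (1 + o(1))` as `n → ∞`. -/
def IsJostSolution (a b : ℕ → ℝ) (s : Side) (z : ℂ) (F : ℕ → ℂ) : Prop :=
  SolvesJacobi a b z F ∧ Tendsto (fun n => F (n + 1) / q a b s n z) atTop (𝓝 1)

open Classical in
/-- The Jost solution `{f_n(z)}`, `n = -1, 0, 1, …`, with the index shifted by one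
(and zero if there is none). -/
noncomputable def jostSeq (a b : ℕ → ℝ) (s : Side) (z : ℂ) : ℕ → ℂ :=
  if h : ∃ F, IsJostSolution a b s z F then h.choose else 0

/-- The member `f_n(z)`, `n ≥ 0`, of the Jost solution. -/
noncomputable def f (a b : ℕ → ℝ) (s : Side) (n : ℕ) (z : ℂ) : ℂ := jostSeq a b s z (n + 1)

/-- The Wronskian `Ω(z) = {P(z), f(z)}`, evaluated at `n = -1`. -/
noncomputable def Omega (a b : ℕ → ℝ) (s : Side) (z : ℂ) : ℂ :=
  wronskian a (polySeq a b z) (jostSeq a b s z) 0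

end LongRangeJacobi

namespace LongRangeJacobi

/-! ### The branch of the square root and the function `ζ` -/

/-! Outside `[-1, 1]` the resolvent formula is the usual Green function construction: `P` satisfies
the boundary condition at `n = -1`, the Jost solution is square summable, and the two are glued with
their Wronskian `Ω`. The analytic substance is to construct the Jost solution and to control it
uniformly up to the edges of the cut.

Write `f_n = q_n u_n`. In coordinates along the two local modes, `ζ_n` and `ζ_n⁻¹`, the Jacobi
equation becomes a first order system for a pair of components, perturbed only by increments of `a_n
ζ_n` and `a_n ζ_n⁻¹`. These are summable because `a` and `b` have bounded variation
(`exists_scaledRoot_bounds`). Since `|ζ_n| ≤ 1` on the closed half-plane, the system is stable when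
solved from infinity, which gives `u_n → 1` (`exists_solution_asymptotic_ansatz`). Solved forwards,
the same system bounds `q_n P_n` (`exists_bound_mul_ansatz`). Both lemmas hold in any normed
commutative ring (complete for the first one) and are applied in `C(K, ℂ)`, so continuity in `z` and
uniformity on `K` come with existence (`exists_jost_family`). The limiting absorption principle and
the estimates follow once `Ω ≠ 0`.

On `(-1, 1)`, `Ω` cannot vanish: `f` would be a multiple of the real solution `P`, whereas `f_{n+1}
/ f_n` tends to the non-real number `ζ`. Outside `[-1, 1]`, `Ω = 0` means that `P` is square
summable, which characterizes eigenvalues.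

The spectral part is independent of the Jost solutions. `J` is a compact perturbation of the free
operator, whose spectrum lies in `[-1, 1]`, so off the cut the Fredholm alternative makes `J - z`
invertible unless `z` is an eigenvalue. Analyticity is that of inversion in a Banach algebra. At an
eigenvalue, adding the rank one eigenprojection moves it away and exhibits the resolvent as an
analytic part plus a simple pole (`exists_entry_eq_add_pole`). -/

theorem cpow_half_sq (w : ℂ) : (w ^ (1 / 2 : ℂ)) ^ 2 = w := by
  have := Complex.cpow_ofNat_inv_pow w 2
  rw [one_div]
  exact this

/-- The principal root halves an argument in `[0, π]`, so it maps the closed upper half-plane into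
the closed first quadrant. This drives all estimates of the branch, up to the boundary. -/
theorem cpow_half_quadrant {w : ℂ} (hw : 0 ≤ w.im) :
    0 ≤ (w ^ (1 / 2 : ℂ)).re ∧ 0 ≤ (w ^ (1 / 2 : ℂ)).im := by
  rcases eq_or_ne w 0 with rfl | h0
  · simp
  have h1 : 0 ≤ w.arg := Complex.arg_nonneg_iff.2 hw
  have h2 := Complex.arg_le_pi w
  have hre : (Complex.log w * (1 / 2)).re = Real.log ‖w‖ / 2 := by
    simp [Complex.mul_re, Complex.log_re]; ring
  have him : (Complex.log w * (1 / 2)).im = w.arg / 2 := by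
    simp [Complex.mul_im, Complex.log_im]; ring
  rw [Complex.cpow_def_of_ne_zero h0, Complex.exp_re, Complex.exp_im, hre, him]
  constructor
  · exact mul_nonneg (Real.exp_pos _).le
      (Real.cos_nonneg_of_mem_Icc ⟨by linarith [Real.pi_pos], by linarith⟩)
  · exact mul_nonneg (Real.exp_pos _).le
      (Real.sin_nonneg_of_nonneg_of_le_pi (by linarith) (by linarith [Real.pi_pos]))

theorem norm_sub_le_norm_add_of_quadrant {r t : ℂ} (hr : 0 ≤ r.re ∧ 0 ≤ r.im)
    (ht : 0 ≤ t.re ∧ 0 ≤ t.im) : ‖r - t‖ ≤ ‖r + t‖ := by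
  rw [← sq_le_sq₀ (norm_nonneg _) (norm_nonneg _), Complex.sq_norm, Complex.sq_norm,
    Complex.normSq_apply, Complex.normSq_apply]
  simp only [Complex.sub_re, Complex.add_re, Complex.sub_im, Complex.add_im]
  nlinarith [mul_nonneg hr.1 ht.1, mul_nonneg hr.2 ht.2]

/-- For roots `r`, `t` in one quadrant, `|r - t|² ≤ |r - t| |r + t| = |r² - t²|`: Hölder continuity
of order 1/2, valid at the branch point too. -/
theorem norm_cpow_half_sub_le {w w' : ℂ} (hw : 0 ≤ w.im) (hw' : 0 ≤ w'.im) :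
    ‖w ^ (1 / 2 : ℂ) - w' ^ (1 / 2 : ℂ)‖ ≤ √‖w - w'‖ := by
  apply Real.le_sqrt_of_sq_le
  have h := norm_sub_le_norm_add_of_quadrant (cpow_half_quadrant hw) (cpow_half_quadrant hw')
  calc ‖w ^ (1 / 2 : ℂ) - w' ^ (1 / 2 : ℂ)‖ ^ 2
      ≤ ‖w ^ (1 / 2 : ℂ) - w' ^ (1 / 2 : ℂ)‖ * ‖w ^ (1 / 2 : ℂ) + w' ^ (1 / 2 : ℂ)‖ := by
        rw [sq]; gcongr
    _ = ‖w - w'‖ := by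
        rw [← norm_mul]
        congr 1
        linear_combination cpow_half_sq w - cpow_half_sq w'

theorem norm_cpow_half (w : ℂ) : ‖w ^ (1 / 2 : ℂ)‖ = √‖w‖ := by
  rw [eq_comm, Real.sqrt_eq_iff_eq_sq (norm_nonneg _) (norm_nonneg _), ← norm_pow, cpow_half_sq]

theorem sqrtEdge_lower (w : ℂ) : sqrtEdge .lower w = conj (sqrtEdge .upper (conj w)) := rfl

theorem zeta_lower (w : ℂ) : zeta .lower w = conj (zeta .upper (conj w)) := by
  simp [zeta, sqrtEdge_lower]

theorem mem_closedHalf_lower {w : ℂ} :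
    w ∈ Side.lower.closedHalf ↔ conj w ∈ Side.upper.closedHalf := by
  simp [Side.closedHalf]

theorem conj_mem_cut {w : ℂ} : conj w ∈ cut ↔ w ∈ cut := by
  constructor
  · rintro ⟨x, hx, h⟩
    refine ⟨x, hx, ?_⟩
    have := congrArg conj h
    simpa using this
  · rintro ⟨x, hx, rfl⟩
    exact ⟨x, hx, by simp⟩

theorem sqrtEdge_sq (s : Side) (w : ℂ) : sqrtEdge s w ^ 2 = w ^ 2 - 1 := by
  have key : ∀ w, sqrtEdge .upper w ^ 2 = w ^ 2 - 1 := fun w => by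
    rw [sqrtEdge, mul_pow, cpow_half_sq, cpow_half_sq]; ring
  cases s with
  | upper => exact key w
  | lower => rw [sqrtEdge_lower, ← map_pow, key]; simp

theorem zeta_mul_add (s : Side) (w : ℂ) : zeta s w * (w + sqrtEdge s w) = 1 := by
  rw [zeta]; linear_combination - sqrtEdge_sq s w

theorem zeta_ne_zero (s : Side) (w : ℂ) : zeta s w ≠ 0 :=
  left_ne_zero_of_mul_eq_one (zeta_mul_add s w)

/-- With `r`, `t` the roots of `w - 1`, `w + 1`, both `ζ = (r - t)² / 2` and `ζ⁻¹ = (r + t)² / 2`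
are squares up to a factor, so that `|ζ| ≤ |ζ⁻¹|` reduces to the quadrant inequality. -/
theorem zeta_upper_eq (w : ℂ) :
    zeta .upper w = ((w - 1) ^ (1 / 2 : ℂ) - (w + 1) ^ (1 / 2 : ℂ)) ^ 2 / 2 := by
  rw [zeta, sqrtEdge]
  linear_combination -(cpow_half_sq (w - 1) + cpow_half_sq (w + 1)) / 2

theorem add_sqrtEdge_upper_eq (w : ℂ) :
    w + sqrtEdge .upper w = ((w - 1) ^ (1 / 2 : ℂ) + (w + 1) ^ (1 / 2 : ℂ)) ^ 2 / 2 := by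
  rw [sqrtEdge]
  linear_combination -(cpow_half_sq (w - 1) + cpow_half_sq (w + 1)) / 2

theorem norm_zeta_upper_le {w : ℂ} (hw : 0 ≤ w.im) :
    ‖zeta .upper w‖ ≤ ‖w + sqrtEdge .upper w‖ := by
  rw [zeta_upper_eq, add_sqrtEdge_upper_eq, norm_div, norm_div, norm_pow, norm_pow]
  gcongr
  exact norm_sub_le_norm_add_of_quadrant (cpow_half_quadrant (by simpa using hw))
    (cpow_half_quadrant (by simpa using hw))

theorem norm_zeta_le_one {s : Side} {w : ℂ} (hw : w ∈ s.closedHalf) : ‖zeta s w‖ ≤ 1 := by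
  have key : ∀ w : ℂ, 0 ≤ w.im → ‖zeta .upper w‖ ≤ 1 := fun w hw => by
    have h := norm_zeta_upper_le hw
    have h1 : ‖zeta .upper w‖ * ‖w + sqrtEdge .upper w‖ = 1 := by
      rw [← norm_mul, zeta_mul_add, norm_one]
    nlinarith [norm_nonneg (zeta .upper w)]
  cases s with
  | upper => exact key w hw
  | lower =>
    rw [zeta_lower, Complex.norm_conj]
    exact key _ (mem_closedHalf_lower.1 hw)

theorem norm_zeta_lt_one {s : Side} {w : ℂ} (hw : w ∈ s.closedHalf) (hc : w ∉ cut) :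
    ‖zeta s w‖ < 1 := by
  have key : ∀ w : ℂ, 0 ≤ w.im → w ∉ cut → ‖zeta .upper w‖ < 1 := fun w hw hc => by
    have h := norm_zeta_upper_le hw
    have h1 : ‖zeta .upper w‖ * ‖w + sqrtEdge .upper w‖ = 1 := by
      rw [← norm_mul, zeta_mul_add, norm_one]
    rcases h.lt_or_eq with h | h
    · nlinarith [norm_nonneg (zeta .upper w)]
    exfalso
    rw [zeta_upper_eq, add_sqrtEdge_upper_eq, norm_div, norm_div, norm_pow, norm_pow] at h
    set r := (w - 1) ^ (1 / 2 : ℂ) with hr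
    set t := (w + 1) ^ (1 / 2 : ℂ) with ht
    have hrq : 0 ≤ r.re ∧ 0 ≤ r.im := cpow_half_quadrant (by simpa using hw)
    have htq : 0 ≤ t.re ∧ 0 ≤ t.im := cpow_half_quadrant (by simpa using hw)
    have hr2 : r ^ 2 = w - 1 := cpow_half_sq _
    have ht2 : t ^ 2 = w + 1 := cpow_half_sq _
    -- Equality in the quadrant inequality forces both coordinate products of `r` and `t` to vanish.
    -- Then `w - 1 = r²` and `w + 1 = t²` are real, and in each of the four cases `w` is confined to
    -- `[-1, 1]`.
    have h2 : ‖r - t‖ ^ 2 = ‖r + t‖ ^ 2 := by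
      have h2 : ‖(2 : ℂ)‖ ≠ 0 := by simp
      field_simp at h
      exact h
    rw [Complex.sq_norm, Complex.sq_norm, Complex.normSq_apply, Complex.normSq_apply] at h2
    simp only [Complex.sub_re, Complex.add_re, Complex.sub_im, Complex.add_im] at h2
    have p1 := mul_nonneg hrq.1 htq.1
    have p2 := mul_nonneg hrq.2 htq.2
    have q1 : r.re * t.re = 0 := by nlinarith
    have q2 : r.im * t.im = 0 := by nlinarith
    have e1 := congrArg Complex.re hr2
    have e2 := congrArg Complex.im hr2
    have e3 := congrArg Complex.re ht2
    have e4 := congrArg Complex.im ht2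
    simp only [sq, Complex.mul_re, Complex.mul_im, Complex.sub_re, Complex.add_re, Complex.sub_im,
      Complex.add_im, Complex.one_re, Complex.one_im] at e1 e2 e3 e4
    have hfin : w.im = 0 ∧ -1 ≤ w.re ∧ w.re ≤ 1 := by
      rcases mul_eq_zero.1 q1 with h | h <;> rcases mul_eq_zero.1 q2 with h' | h' <;>
        simp only [h, h', mul_zero, zero_mul, sub_zero, zero_sub, add_zero] at e1 e2 e3 e4 <;>
        refine ⟨by linarith, ?_, ?_⟩ <;> linarith [mul_self_nonneg r.re,
          mul_self_nonneg r.im, mul_self_nonneg t.re, mul_self_nonneg t.im]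
    exact hc ⟨w.re, ⟨hfin.2.1, hfin.2.2⟩, by apply Complex.ext <;> simp [hfin.1]⟩
  cases s with
  | upper => exact key w hw hc
  | lower =>
    rw [zeta_lower, Complex.norm_conj]
    exact key _ (mem_closedHalf_lower.1 hw) (by rwa [conj_mem_cut])

/-- A real root would have a nonnegative square, but `x² - 1 < 0`. -/
theorem zeta_im_ne_zero (s : Side) {x : ℝ} (hx : x ∈ Ioo (-1 : ℝ) 1) : (zeta s x).im ≠ 0 := by
  intro h
  have h1 := sqrtEdge_sq s x
  rw [zeta, Complex.sub_im, Complex.ofReal_im, zero_sub, neg_eq_zero] at h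
  have h2 := congrArg Complex.re h1
  simp only [sq, Complex.mul_re, h, Complex.sub_re, Complex.ofReal_re, Complex.ofReal_im,
    Complex.one_re] at h2
  nlinarith [hx.1, hx.2, mul_self_nonneg (sqrtEdge s x).re]

theorem norm_sqrtEdge_sub_le {s : Side} {w w' : ℂ} (hw : w ∈ s.closedHalf) (hw' : w' ∈ s.closedHalf)
    {B : ℝ} (hB : ‖w‖ ≤ B) (hB' : ‖w'‖ ≤ B) :
    ‖sqrtEdge s w - sqrtEdge s w'‖ ≤ 2 * √(B + 1) * √‖w - w'‖ := by
  have key : ∀ w w' : ℂ, 0 ≤ w.im → 0 ≤ w'.im → ‖w‖ ≤ B → ‖w'‖ ≤ B →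
      ‖sqrtEdge .upper w - sqrtEdge .upper w'‖ ≤ 2 * √(B + 1) * √‖w - w'‖ := by
    intro w w' hw hw' hB hB'
    have h1 : ‖(w - 1) ^ (1 / 2 : ℂ) - (w' - 1) ^ (1 / 2 : ℂ)‖ ≤ √‖w - w'‖ := by
      refine (norm_cpow_half_sub_le (by simpa using hw) (by simpa using hw')).trans_eq ?_
      congr 2; ring
    have h2 : ‖(w + 1) ^ (1 / 2 : ℂ) - (w' + 1) ^ (1 / 2 : ℂ)‖ ≤ √‖w - w'‖ := by
      refine (norm_cpow_half_sub_le (by simpa using hw) (by simpa using hw')).trans_eq ?_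
      congr 2; ring
    have h3 : ‖(w + 1) ^ (1 / 2 : ℂ)‖ ≤ √(B + 1) := by
      rw [norm_cpow_half]
      exact Real.sqrt_le_sqrt ((norm_add_le _ _).trans (by simpa using hB))
    have h4 : ‖(w' - 1) ^ (1 / 2 : ℂ)‖ ≤ √(B + 1) := by
      rw [norm_cpow_half]
      exact Real.sqrt_le_sqrt ((norm_sub_le _ _).trans (by simpa using hB'))
    rw [sqrtEdge, sqrtEdge]
    generalize (w - 1) ^ (1 / 2 : ℂ) = p at *
    generalize (w + 1) ^ (1 / 2 : ℂ) = q at *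
    generalize (w' - 1) ^ (1 / 2 : ℂ) = p' at *
    generalize (w' + 1) ^ (1 / 2 : ℂ) = q' at *
    calc ‖p * q - p' * q'‖ = ‖(p - p') * q + p' * (q - q')‖ := by congr 1; ring
      _ ≤ ‖p - p'‖ * ‖q‖ + ‖p'‖ * ‖q - q'‖ := by
        refine (norm_add_le _ _).trans ?_
        rw [norm_mul, norm_mul]
      _ ≤ √‖w - w'‖ * √(B + 1) + √(B + 1) * √‖w - w'‖ := by gcongr
      _ = _ := by ring
  cases s with
  | upper => exact key w w' hw hw' hB hB'
  | lower =>
    have := key (conj w) (conj w') (mem_closedHalf_lower.1 hw) (mem_closedHalf_lower.1 hw')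
      (by simpa using hB) (by simpa using hB')
    rw [← map_sub, Complex.norm_conj] at this
    rwa [sqrtEdge_lower, sqrtEdge_lower, ← map_sub, Complex.norm_conj]

theorem continuousOn_sqrtEdge (s : Side) : ContinuousOn (sqrtEdge s) s.closedHalf := by
  intro w hw
  have hb : ∀ᶠ w' in 𝓝[s.closedHalf] w, ‖sqrtEdge s w' - sqrtEdge s w‖
      ≤ 2 * √(‖w‖ + 1 + 1) * √‖w' - w‖ := by
    have h1 : ∀ᶠ w' in 𝓝[s.closedHalf] w, ‖w'‖ < ‖w‖ + 1 :=
      nhdsWithin_le_nhds (continuous_norm.continuousAt.eventually_lt_const (by linarith))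
    filter_upwards [self_mem_nhdsWithin, h1] with w' hw' h1
    exact norm_sqrtEdge_sub_le hw' hw h1.le (by linarith)
  rw [ContinuousWithinAt, tendsto_iff_norm_sub_tendsto_zero]
  refine squeeze_zero' (Eventually.of_forall fun _ => norm_nonneg _) hb ?_
  have : ContinuousAt (fun w' : ℂ => 2 * √(‖w‖ + 1 + 1) * √‖w' - w‖) w := by fun_prop
  have h2 := this.tendsto
  simp only [sub_self, norm_zero, Real.sqrt_zero, mul_zero] at h2
  exact h2.mono_left nhdsWithin_le_nhds

theorem isClosed_closedHalf (s : Side) : IsClosed s.closedHalf := by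
  cases s
  · exact isClosed_le continuous_const Complex.continuous_im
  · exact isClosed_le Complex.continuous_im continuous_const

/-- The spectral parameter `(z - b_k) / (2 a_k)` stays in the closed half-plane of `z`. -/
theorem shifted_mem_closedHalf {s : Side} {z : ℂ} (hz : z ∈ s.closedHalf) {α : ℝ} (hα : 0 < α)
    (β : ℝ) : (z - β) / (2 * α) ∈ s.closedHalf := by
  have h : ((z - β) / (2 * α)).im = z.im / (2 * α) := by
    have : (2 * (α : ℂ)) = ((2 * α : ℝ) : ℂ) := by push_cast; rfl
    rw [this, Complex.div_ofReal_im]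
    simp
  cases s
  · simp only [Side.closedHalf, mem_ofPred_eq] at *
    rw [h]; positivity
  · simp only [Side.closedHalf, mem_ofPred_eq] at *
    rw [h]
    exact div_nonpos_of_nonpos_of_nonneg hz (by positivity)

/-! ### Stable backward and forward recursions -/

/-- Discrete Gronwall inequality, from `1 + ε ≤ exp ε`. -/
theorem prod_exp_bound {u ε : ℕ → ℝ} (hε0 : ∀ n, 0 ≤ ε n) (hε : Summable ε) (hu0 : ∀ n, 0 ≤ u n)
    (hu : ∀ n, u (n + 1) ≤ (1 + ε n) * u n) (n : ℕ) : u n ≤ Real.exp (∑' k, ε k) * u 0 := by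
  have h : u n ≤ Real.exp (∑ k ∈ Finset.range n, ε k) * u 0 := by
    induction n with
    | zero => simp
    | succ n ih =>
      rw [Finset.sum_range_succ, Real.exp_add]
      calc u (n + 1) ≤ (1 + ε n) * u n := hu n
        _ ≤ Real.exp (ε n) * (Real.exp (∑ k ∈ Finset.range n, ε k) * u 0) := by
          have := Real.add_one_le_exp (ε n)
          have h0 := hε0 n
          have h1 := hu0 n
          gcongr
          linarith
        _ = _ := by ring
  refine h.trans ?_
  have := hε.sum_le_tsum (Finset.range n) (fun k _ => hε0 k)
  have h1 := hu0 0
  gcongr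

/-- A backward recursion `w_n = T_n w_{n+1}` whose maps have Lipschitz constants `1 + ε_n` and which
is solved by `v` up to errors `ε_n`, with `∑ ε_n < ∞`, has a solution asymptotic to `v`. -/
theorem exists_backward_solution {E : Type*} [NormedAddCommGroup E] [CompleteSpace E]
    {T : ℕ → E → E} {v : ℕ → E} {ε : ℕ → ℝ} (hε0 : ∀ n, 0 ≤ ε n) (hε : Summable ε)
    (hT : ∀ n x y, ‖T n x - T n y‖ ≤ (1 + ε n) * ‖x - y‖)
    (hv : ∀ n, ‖T n (v (n + 1)) - v n‖ ≤ ε n) :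
    ∃ w : ℕ → E, (∀ n, w n = T n (w (n + 1))) ∧ Tendsto (fun n => w n - v n) atTop (𝓝 0) := by
  -- `W j n = T_n T_{n+1} ⋯ T_{n+j-1} v_{n+j}`: start from `v` at the far index `n + j` and come
  -- back. Consecutive approximants differ by the defect `ε_{n+j}` times a bounded product of
  -- Lipschitz constants, so they converge, within a tail of `∑ ε` of `v`.
  let W : ℕ → ℕ → E := fun j => Nat.rec v (fun _ g n => T n (g (n + 1))) j
  have hW0 : W 0 = v := rfl
  have hWs : ∀ j n, W (j + 1) n = T n (W j (n + 1)) := fun _ _ => rfl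
  have step : ∀ j n, ‖W (j + 1) n - W j n‖
      ≤ Real.exp (∑ k ∈ Finset.range j, ε (n + k)) * ε (n + j) := by
    intro j
    induction j with
    | zero => intro n; simpa [hWs, hW0] using hv n
    | succ j ih =>
      intro n
      rw [hWs (j + 1), hWs j]
      refine (hT n _ _).trans ?_
      rw [Finset.sum_range_succ', Real.exp_add, add_zero]
      have h1 := ih (n + 1)
      have h2 := Real.add_one_le_exp (ε n)
      have e1 : ∀ k, n + 1 + k = n + (k + 1) := fun k => by ring
      simp only [e1] at h1
      calc (1 + ε n) * ‖W (j + 1) (n + 1) - W j (n + 1)‖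
          ≤ Real.exp (ε n) * (Real.exp (∑ k ∈ Finset.range j, ε (n + (k + 1)))
              * ε (n + (j + 1))) := by
            have := hε0 n
            gcongr
            linarith
        _ = _ := by ring
  set C := Real.exp (∑' k, ε k) with hC
  have hshift : ∀ n, Summable fun k => ε (n + k) := fun n => by
    simpa [add_comm] using (summable_nat_add_iff n).2 hε
  have hle : ∀ j n, dist (W j n) (W (j + 1) n) ≤ C * ε (n + j) := by
    intro j n
    rw [dist_comm, dist_eq_norm]
    refine (step j n).trans ?_
    have h1 : ∑ k ∈ Finset.range j, ε (n + k) ≤ ∑' k, ε k := by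
      calc ∑ k ∈ Finset.range j, ε (n + k)
          = ∑ k ∈ (Finset.range j).map (addLeftEmbedding n), ε k := by simp
        _ ≤ _ := hε.sum_le_tsum _ (fun k _ => hε0 k)
    exact mul_le_mul_of_nonneg_right (Real.exp_le_exp.2 h1) (hε0 (n + j))
  have hlim : ∀ n, ∃ l, Tendsto (fun j => W j n) atTop (𝓝 l) := fun n =>
    cauchySeq_tendsto_of_complete
      (cauchySeq_of_dist_le_of_summable _ (fun j => hle j n) ((hshift n).mul_left C))
  choose w hw using hlim
  refine ⟨w, fun n => ?_, ?_⟩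
  · have hcont : Continuous (T n) :=
      (LipschitzWith.of_dist_le_mul (K := ⟨1 + ε n, by linarith [hε0 n]⟩) (fun x y => by
        rw [dist_eq_norm, dist_eq_norm]; exact hT n x y)).continuous
    exact tendsto_nhds_unique ((tendsto_add_atTop_iff_nat 1).2 (hw n))
      ((hcont.tendsto _).comp (hw (n + 1)))
  · have hb : ∀ n, ‖w n - v n‖ ≤ C * ∑' k, ε (k + n) := by
      intro n
      have := dist_le_tsum_of_dist_le_of_tendsto _ (fun j => hle j n) ((hshift n).mul_left C)
        (hw n) 0
      rw [hW0, dist_comm, dist_eq_norm] at this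
      refine this.trans_eq ?_
      rw [← tsum_mul_left]
      congr 1; ext k; congr 2; ring
    refine squeeze_zero_norm hb ?_
    simpa using (tendsto_sum_nat_add ε).const_mul C

/-! ### The diagonalized recursion over a normed commutative ring. -/

section Algebra

variable {A : Type*} [NormedCommRing A]

/-- Diagonalized form of the Jacobi equation `α_n f_n + α_{n+1} f_{n+2} = c_{n+1} f_{n+1}`: the
solution that is asymptotic to the Ansatz `q_n`, `q_{n+1} = ζ_n q_n`. -/
theorem exists_solution_asymptotic_ansatz [CompleteSpace A] {α c ζ η d q : ℕ → A} {ε : ℕ → ℝ}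
    {D : ℝ} (hζη : ∀ n, ζ n * η n = 1) (hc : ∀ n, α n * (ζ n + η n) = c n)
    (hd : ∀ n, α n * (η n - ζ n) * d n = 1) (hq : ∀ n, q (n + 1) = ζ n * q n)
    (hζ1 : ∀ n, ‖ζ n‖ ≤ 1) (hD : ∀ n, ‖d n‖ ≤ D)
    (hε : Summable ε) (hx : ∀ n, ‖α (n + 1) * ζ (n + 1) - α n * ζ n‖ ≤ ε n)
    (hy : ∀ n, ‖α (n + 1) * η (n + 1) - α n * η n‖ ≤ ε n) :
    ∃ u : ℕ → A, Tendsto u atTop (𝓝 1) ∧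
      ∀ n, α n * (q n * u n) + α (n + 1) * (q (n + 2) * u (n + 2))
        = c (n + 1) * (q (n + 1) * u (n + 1)) := by
  have hD0 : 0 ≤ D := (norm_nonneg _).trans (hD 0)
  have hε0 : ∀ n, 0 ≤ ε n := fun n => (norm_nonneg _).trans (hx n)
  set ρx : ℕ → A := fun n => α (n + 1) * ζ (n + 1) - α n * ζ n with hρx
  set ρy : ℕ → A := fun n => α (n + 1) * η (n + 1) - α n * η n with hρy
  -- For `f = q u` the components are meant to be `Y_n = α_n ζ_n (u_{n+1} - u_n)` and `X_n = α_n
  -- (η_n - ζ_n) u_n - Y_n`, so `(X + Y) d` recovers `u`. Backwards, `X` is multiplied by `1` and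
  -- `Y` by `ζ_n²`, up to the increments `ρx`, `ρy`; hence the Lipschitz constants are `1 + O(ε_n)`.
  let T : ℕ → A × A → A × A := fun n p =>
    (p.1 + ρx n * ((p.1 + p.2) * d (n + 1)),
      ζ n * (ζ n * (p.2 - ρy n * ((p.1 + p.2) * d (n + 1)))))
  -- The components that belong to `u = 1`.
  let v : ℕ → A × A := fun n => (α n * (η n - ζ n), 0)
  have hζmul : ∀ n x, ‖ζ n * x‖ ≤ ‖x‖ := fun n x =>
    (norm_mul_le _ _).trans (mul_le_of_le_one_left (norm_nonneg _) (hζ1 n))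
  have hT : ∀ n x y, ‖T n x - T n y‖ ≤ (1 + (1 + 2 * D) * ε n) * ‖x - y‖ := by
    intro n x y
    have h1 : ‖(x.1 - y.1)‖ ≤ ‖x - y‖ := norm_fst_le (x - y)
    have h2 : ‖(x.2 - y.2)‖ ≤ ‖x - y‖ := norm_snd_le (x - y)
    have hsum : ‖((x.1 - y.1) + (x.2 - y.2)) * d (n + 1)‖ ≤ 2 * ‖x - y‖ * D := by
      refine (norm_mul_le _ _).trans ?_
      gcongr
      · exact (norm_add_le _ _).trans (by linarith)
      · exact hD _
    have hε' := hε0 n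
    have hxy := norm_nonneg (x - y)
    have hr : ∀ r : A, ‖r‖ ≤ ε n → ∀ t : A, ‖t‖ ≤ ‖x - y‖ →
        ‖t‖ + ‖r * (((x.1 - y.1) + (x.2 - y.2)) * d (n + 1))‖
          ≤ (1 + (1 + 2 * D) * ε n) * ‖x - y‖ := by
      intro r hr t ht
      have : ‖r * (((x.1 - y.1) + (x.2 - y.2)) * d (n + 1))‖ ≤ ε n * (2 * ‖x - y‖ * D) := by
        refine (norm_mul_le _ _).trans ?_
        gcongr
      nlinarith [mul_nonneg hε' hxy]
    rw [Prod.norm_def]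
    refine max_le ?_ ?_
    · have : (T n x - T n y).1
          = (x.1 - y.1) + ρx n * (((x.1 - y.1) + (x.2 - y.2)) * d (n + 1)) := by
        simp only [T, Prod.fst_sub]; ring
      rw [this]
      exact (norm_add_le _ _).trans (hr _ (hx n) _ h1)
    · have : (T n x - T n y).2 = ζ n * (ζ n * ((x.2 - y.2)
          - ρy n * (((x.1 - y.1) + (x.2 - y.2)) * d (n + 1)))) := by
        simp only [T, Prod.snd_sub]; ring
      rw [this]
      exact ((hζmul _ _).trans (hζmul _ _)).trans ((norm_sub_le _ _).trans (hr _ (hy n) _ h2))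
  have hv : ∀ n, ‖T n (v (n + 1)) - v n‖ ≤ (1 + 2 * D) * ε n := by
    intro n
    have h1 : T n (v (n + 1)) - v n = (ρy n, ζ n * (ζ n * (- ρy n))) := by
      ext
      · simp only [T, v, Prod.fst_sub]
        linear_combination ρx n * hd (n + 1)
      · simp only [T, v, Prod.snd_sub]
        linear_combination -(ζ n * (ζ n * ρy n)) * hd (n + 1)
    rw [h1, Prod.norm_def]
    have h2 : ε n ≤ (1 + 2 * D) * ε n := by nlinarith [hε0 n, mul_nonneg hD0 (hε0 n)]
    refine max_le ((hy n).trans h2) (((hζmul _ _).trans (hζmul _ _)).trans ?_)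
    rw [norm_neg]
    exact (hy n).trans h2
  obtain ⟨w, hw, hwlim⟩ := exists_backward_solution (T := T) (v := v)
    (fun n => mul_nonneg (by linarith) (hε0 n)) (hε.mul_left (1 + 2 * D)) hT hv
  have hw1 : ∀ n, (w n).1 = (w (n + 1)).1
      + ρx n * (((w (n + 1)).1 + (w (n + 1)).2) * d (n + 1)) := fun n => congrArg Prod.fst (hw n)
  have hw2 : ∀ n, (w n).2 = ζ n * (ζ n * ((w (n + 1)).2
      - ρy n * (((w (n + 1)).1 + (w (n + 1)).2) * d (n + 1)))) := fun n => congrArg Prod.snd (hw n)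
  set u : ℕ → A := fun n => ((w n).1 + (w n).2) * d n with hu
  -- The fixed sequence `w` has the intended meaning: `X + η² Y` and `X + Y` give `u_{n+1}` and
  -- `u_n`, and `η² - 1 = η (η - ζ)`. The factor `η - ζ` cancels because `d` makes `α (η - ζ)` a
  -- unit.
  have hY : ∀ n, (w n).2 = α n * ζ n * (u (n + 1) - u n) := by
    intro n
    have e1 : (w n).1 + η n * (η n * (w n).2) = α n * (η n - ζ n) * u (n + 1) := by
      rw [hw1 n, hw2 n]
      simp only [hu, hρx, hρy]
      linear_combination ((w (n + 1)).2 - ρy n * (((w (n + 1)).1 + (w (n + 1)).2) * d (n + 1)))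
        * (ζ n * η n + 1) * hζη n - ((w (n + 1)).1 + (w (n + 1)).2) * hd (n + 1)
    have e2 : (w n).1 + (w n).2 = α n * (η n - ζ n) * u n := by
      simp only [hu]
      linear_combination -((w n).1 + (w n).2) * hd n
    have e3 : (η n - ζ n) * (η n * (w n).2 - α n * (u (n + 1) - u n)) = 0 := by
      linear_combination e1 - e2 - (w n).2 * hζη n
    have e4 : η n * (w n).2 = α n * (u (n + 1) - u n) := by
      linear_combination (α n * d n) * e3
        - (η n * (w n).2 - α n * (u (n + 1) - u n)) * hd n
    linear_combination ζ n * e4 - (w n).2 * hζη n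
  refine ⟨u, ?_, fun n => ?_⟩
  · have h1 : ∀ n, u n - 1 = ((w n - v n).1 + (w n - v n).2) * d n := by
      intro n
      simp only [hu, v, Prod.fst_sub, Prod.snd_sub]
      linear_combination hd n
    rw [tendsto_iff_norm_sub_tendsto_zero]
    have h2 : Tendsto (fun n => 2 * ‖w n - v n‖ * D) atTop (𝓝 0) := by
      simpa using ((tendsto_norm_zero.comp hwlim).const_mul 2).mul_const D
    refine squeeze_zero (fun _ => norm_nonneg _) (fun n => ?_) h2
    rw [h1]
    refine (norm_mul_le _ _).trans ?_
    gcongr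
    · exact (norm_add_le _ _).trans
        (by linarith [norm_fst_le (w n - v n), norm_snd_le (w n - v n)])
    · exact hD n
  · have e1 := hw2 n
    have e2 : ((w (n + 1)).1 + (w (n + 1)).2) * d (n + 1) = u (n + 1) := rfl
    rw [e2, hY n, hY (n + 1)] at e1
    rw [hq (n + 1), hq n, ← hc (n + 1)]
    simp only [hρy] at e1
    linear_combination -(q n * η n) * e1
      + q n * (α n * (u (n + 1) - u n) + ζ n * (α (n + 1) * η (n + 1) - α n * η n) * u (n + 1)
        - ζ n * (α (n + 1) * ζ (n + 1) * (u (n + 2) - u (n + 1)))) * hζη n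
      - q n * α n * u (n + 1) * hζη n

/-- Every solution of the Jacobi equation is bounded by a multiple of `q_n⁻¹`. -/
theorem exists_bound_mul_ansatz {α c ζ η d q p : ℕ → A} {ε : ℕ → ℝ} {D : ℝ}
    (hζη : ∀ n, ζ n * η n = 1) (hc : ∀ n, α n * (ζ n + η n) = c n)
    (hd : ∀ n, α n * (η n - ζ n) * d n = 1) (hq : ∀ n, q (n + 1) = ζ n * q n)
    (hζ1 : ∀ n, ‖ζ n‖ ≤ 1) (hD : ∀ n, ‖d n‖ ≤ D)
    (hε : Summable ε) (hx : ∀ n, ‖α (n + 1) * ζ (n + 1) - α n * ζ n‖ ≤ ε n)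
    (hy : ∀ n, ‖α (n + 1) * η (n + 1) - α n * η n‖ ≤ ε n)
    (hp : ∀ n, α n * p n + α (n + 1) * p (n + 2) = c (n + 1) * p (n + 1)) :
    ∃ C : ℝ, ∀ n, ‖p n * q n‖ ≤ C := by
  have hD0 : 0 ≤ D := (norm_nonneg _).trans (hD 0)
  have hε0 : ∀ n, 0 ≤ ε n := fun n => (norm_nonneg _).trans (hx n)
  have hζmul : ∀ n x, ‖ζ n * x‖ ≤ ‖x‖ := fun n x =>
    (norm_mul_le _ _).trans (mul_le_of_le_one_left (norm_nonneg _) (hζ1 n))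
  -- Each combination annihilates one local mode: `X` removes the growing one, `Y` the decaying one.
  -- After multiplication by `q_n` the forward step multiplies `X` by `ζ_n²` and `Y` by `1`, up to
  -- `ε_n`, and `p q = d (X + Y)`.
  set X : ℕ → A := fun n => q n * (α n * (η n * p n - p (n + 1))) with hX
  set Y : ℕ → A := fun n => q n * (α n * (p (n + 1) - ζ n * p n)) with hY
  set g : ℕ → A := fun n => d n * (ζ n * (ζ n * X n) + Y n) with hg
  have hgp : ∀ n, g n = q (n + 1) * p (n + 1) := by
    intro n
    simp only [hg, hX, hY, hq n]
    linear_combination ζ n * q n * p (n + 1) * hd n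
      + d n * α n * q n * (ζ n * p n - p (n + 1)) * hζη n
  have hX' : ∀ n, X (n + 1)
      = ζ n * (ζ n * X n) - (α (n + 1) * ζ (n + 1) - α n * ζ n) * g n := by
    intro n
    rw [hgp]
    simp only [hX, hq n]
    linear_combination -(ζ n * q n) * hp n - ζ n * q n * α n * p n * hζη n
      + ζ n * q n * p (n + 1) * hc (n + 1)
  have hY' : ∀ n, Y (n + 1) = Y n + (α (n + 1) * η (n + 1) - α n * η n) * g n := by
    intro n
    rw [hgp]
    simp only [hY, hq n]
    linear_combination ζ n * q n * hp n - ζ n * q n * p (n + 1) * hc (n + 1)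
      + q n * α n * p (n + 1) * hζη n
  set M : ℕ → ℝ := fun n => max ‖X n‖ ‖Y n‖ with hM
  have hM0 : ∀ n, 0 ≤ M n := fun n => le_max_of_le_left (norm_nonneg _)
  have hgM : ∀ n, ‖g n‖ ≤ D * (2 * M n) := by
    intro n
    refine (norm_mul_le _ _).trans ?_
    have h1 : ‖X n‖ ≤ M n := le_max_left _ _
    have h2 : ‖Y n‖ ≤ M n := le_max_right _ _
    have h3 := (hζmul n (ζ n * X n)).trans (hζmul n (X n))
    gcongr
    · exact hD n
    · exact (norm_add_le _ _).trans (by linarith)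
  have hstep : ∀ n, M (n + 1) ≤ (1 + 2 * D * ε n) * M n := by
    intro n
    have h1 : ‖X n‖ ≤ M n := le_max_left _ _
    have h2 : ‖Y n‖ ≤ M n := le_max_right _ _
    have h3 := (hζmul n (ζ n * X n)).trans (hζmul n (X n))
    have h4 : ∀ r : A, ‖r‖ ≤ ε n → ‖r * g n‖ ≤ ε n * (D * (2 * M n)) := fun r hr => by
      refine (norm_mul_le _ _).trans ?_
      have := hε0 n
      gcongr
      exact hgM n
    refine max_le ?_ ?_
    · rw [hX']
      refine (norm_sub_le _ _).trans ?_
      linarith [h4 _ (hx n)]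
    · rw [hY']
      refine (norm_add_le _ _).trans ?_
      linarith [h4 _ (hy n)]
  have hbound := prod_exp_bound (fun n => mul_nonneg (by linarith) (hε0 n))
    (hε.mul_left (2 * D)) hM0 hstep
  refine ⟨D * (2 * (Real.exp (∑' k, 2 * D * ε k) * M 0)), fun n => ?_⟩
  have h1 : p n * q n = d n * (X n + Y n) := by
    simp only [hX, hY]
    linear_combination -(p n * q n) * hd n
  rw [h1]
  refine (norm_mul_le _ _).trans ?_
  have h1 : ‖X n‖ ≤ M n := le_max_left _ _
  have h2 : ‖Y n‖ ≤ M n := le_max_right _ _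
  gcongr
  · exact hD n
  · exact (norm_add_le _ _).trans (by linarith [hbound n])

end Algebra

/-! ### The Ansatz on compact sets -/

/-- `2 a_n √(z_n² - 1)`, where `z_n = (z - b_n) / (2 a_n)`. -/
noncomputable def scaledRoot (a b : ℕ → ℝ) (s : Side) (n : ℕ) (z : ℂ) : ℂ :=
  2 * a n * sqrtEdge s ((z - b n) / (2 * a n))

theorem scaledRoot_sq {a b : ℕ → ℝ} (ha : ∀ n, 0 < a n) (s : Side) (n : ℕ) (z : ℂ) :
    scaledRoot a b s n z ^ 2 = (z - b n) ^ 2 - 4 * (a n : ℂ) ^ 2 := by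
  have h : (a n : ℂ) ≠ 0 := by exact_mod_cast (ha n).ne'
  rw [scaledRoot, mul_pow, sqrtEdge_sq]
  field_simp
  ring

theorem continuousOn_shifted {a b : ℕ → ℝ} (ha : ∀ n, 0 < a n) {s : Side} {g : ℂ → ℂ}
    (hg : ContinuousOn g s.closedHalf) (n : ℕ) :
    ContinuousOn (fun z => g ((z - b n) / (2 * a n))) s.closedHalf :=
  hg.comp (by fun_prop) fun _ hz => shifted_mem_closedHalf hz (ha n) _

theorem continuousOn_scaledRoot {a b : ℕ → ℝ} (ha : ∀ n, 0 < a n) (s : Side) (n : ℕ) :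
    ContinuousOn (scaledRoot a b s n) s.closedHalf :=
  continuousOn_const.mul (continuousOn_shifted ha (continuousOn_sqrtEdge s) n)

theorem continuousOn_zeta (s : Side) : ContinuousOn (zeta s) s.closedHalf :=
  continuousOn_id.sub (continuousOn_sqrtEdge s)

theorem continuousOn_q {a b : ℕ → ℝ} (ha : ∀ n, 0 < a n) (s : Side) (n : ℕ) :
    ContinuousOn (q a b s n) s.closedHalf :=
  continuousOn_finsetProd _ fun k _ => continuousOn_shifted ha (continuousOn_zeta s) k

theorem q_ne_zero (a b : ℕ → ℝ) (s : Side) (n : ℕ) (z : ℂ) : q a b s n z ≠ 0 :=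
  Finset.prod_ne_zero_iff.2 fun _ _ => zeta_ne_zero _ _

theorem q_succ (a b : ℕ → ℝ) (s : Side) (n : ℕ) (z : ℂ) :
    q a b s (n + 1) z = zeta s ((z - b n) / (2 * a n)) * q a b s n z := by
  rw [q, Finset.prod_range_succ, mul_comm]; rfl

theorem norm_q_le_one {a b : ℕ → ℝ} (ha : ∀ n, 0 < a n) {s : Side} {z : ℂ}
    (hz : z ∈ s.closedHalf) (n : ℕ) : ‖q a b s n z‖ ≤ 1 := by
  rw [q, norm_prod]
  exact Finset.prod_le_one (fun _ _ => norm_nonneg _)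
    fun k _ => norm_zeta_le_one (shifted_mem_closedHalf hz (ha k) _)

theorem norm_q_antitone {a b : ℕ → ℝ} (ha : ∀ n, 0 < a n) {s : Side} {z : ℂ}
    (hz : z ∈ s.closedHalf) : Antitone fun n => ‖q a b s n z‖ := by
  refine antitone_nat_of_succ_le fun n => ?_
  rw [q_succ, norm_mul]
  exact mul_le_of_le_one_left (norm_nonneg _)
    (norm_zeta_le_one (shifted_mem_closedHalf hz (ha n) _))

theorem continuous_polySeq (a b : ℕ → ℝ) (n : ℕ) : Continuous fun z => polySeq a b z n := by
  induction n using Nat.strong_induction_on with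
  | _ n ih =>
    match n with
    | 0 => simpa [polySeq] using continuous_const
    | 1 => simpa [polySeq] using continuous_const
    | n + 2 =>
      have h1 := ih (n + 1) (by omega)
      have h2 := ih n (by omega)
      simp only [polySeq]
      fun_prop

theorem aPrev_pos {a : ℕ → ℝ} (ha : ∀ n, 0 < a n) (n : ℕ) : 0 < aPrev a n := by
  cases n with
  | zero => norm_num [aPrev]
  | succ n => exact ha n

theorem tendsto_shifted {a b : ℕ → ℝ} (ha : Tendsto a atTop (𝓝 (1 / 2)))
    (hb : Tendsto b atTop (𝓝 0)) (z : ℂ) :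
    Tendsto (fun n => (z - b n) / (2 * a n)) atTop (𝓝 z) := by
  have h1 : Tendsto (fun n => (b n : ℂ)) atTop (𝓝 ((0 : ℝ) : ℂ)) :=
    (Complex.continuous_ofReal.tendsto _).comp hb
  have h2 : Tendsto (fun n => (a n : ℂ)) atTop (𝓝 ((1 / 2 : ℝ) : ℂ)) :=
    (Complex.continuous_ofReal.tendsto _).comp ha
  have h3 := (h1.const_sub z).div (h2.const_mul 2) (by norm_num)
  have h4 : (z - ((0 : ℝ) : ℂ)) / (2 * ((1 / 2 : ℝ) : ℂ)) = z := by push_cast; ring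
  rwa [h4] at h3

/-- On a compact set that does not contain the branch points, `2 a_n √(z_n² - 1)` is bounded away
from zero, and its increments are bounded by those of the coefficients. -/
theorem exists_scaledRoot_bounds {a b : ℕ → ℝ} (ha : ∀ n, 0 < a n)
    (ha_lim : Tendsto a atTop (𝓝 (1 / 2))) (hb_lim : Tendsto b atTop (𝓝 0))
    {s : Side} {K : Set ℂ} (hK : IsCompact K) (hKs : K ⊆ s.closedHalf) (h1 : (1 : ℂ) ∉ K)
    (h2 : (-1 : ℂ) ∉ K) :
    ∃ (N : ℕ) (D C : ℝ), ∀ n, N ≤ n → ∀ z ∈ K, scaledRoot a b s n z ≠ 0 ∧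
      ‖(scaledRoot a b s n z)⁻¹‖ ≤ D ∧
      ‖scaledRoot a b s (n + 1) z - scaledRoot a b s n z‖
        ≤ C * (|a (n + 1) - a n| + |b (n + 1) - b n|) := by
  have hS0 : ∀ z ∈ K, sqrtEdge s z ≠ 0 := by
    intro z hz h
    have h3 := sqrtEdge_sq s z
    rw [h] at h3
    have h4 : (z - 1) * (z + 1) = 0 := by linear_combination -h3
    rcases mul_eq_zero.1 h4 with h5 | h5
    · exact h1 (by rwa [← sub_eq_zero.1 h5])
    · exact h2 (by rwa [← eq_neg_of_add_eq_zero_left h5])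
  obtain ⟨M, hM⟩ := hK.exists_bound_of_continuousOn (f := fun z : ℂ => z) continuousOn_id
  obtain ⟨L, hL⟩ := hK.exists_bound_of_continuousOn ((continuousOn_sqrtEdge s).mono hKs)
  obtain ⟨E, hE⟩ := hK.exists_bound_of_continuousOn
    (((continuousOn_sqrtEdge s).mono hKs).inv₀ hS0)
  rcases K.eq_empty_or_nonempty with rfl | ⟨z₁, hz₁⟩
  · exact ⟨0, 0, 0, by simp⟩
  have hM0 : 0 ≤ M := (norm_nonneg _).trans (hM z₁ hz₁)
  have hE0 : 0 < E := (norm_pos_iff.2 (inv_ne_zero (hS0 z₁ hz₁))).trans_le (hE z₁ hz₁)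
  -- A positive lower bound of `|√(z² - 1)|` on `K`, available because `±1 ∉ K`.
  set m := E⁻¹ with hm
  have hm0 : 0 < m := inv_pos.2 hE0
  have hmS : ∀ z ∈ K, m ≤ ‖sqrtEdge s z‖ := fun z hz => by
    have h3 := hE z hz
    rw [Pi.inv_apply, norm_inv] at h3
    exact inv_le_of_inv_le₀ (norm_pos_iff.2 (hS0 z hz)) h3
  -- Once `a_n > 1/4` and `|b_n| < 1`, `B` bounds the shifted points `z_n`, `t n` bounds `|z_n -
  -- z|`, and `τ n` bounds the distance from the scaled root to `√(z² - 1)`.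
  set B := 2 * (M + 1) with hB
  let t : ℕ → ℝ := fun n => 2 * (|b n| + 2 * |a n - 1 / 2| * M)
  let τ : ℕ → ℝ := fun n => 2 * a n * (2 * √(B + 1) * √(t n)) + |2 * a n - 1| * L
  have hτ : Tendsto τ atTop (𝓝 0) := by
    have e1 : Tendsto (fun n => |b n|) atTop (𝓝 0) := by simpa using hb_lim.abs
    have e2 : Tendsto (fun n => |a n - 1 / 2|) atTop (𝓝 0) := by
      simpa using (ha_lim.sub_const (1 / 2)).abs
    have e3 : Tendsto (fun n => |2 * a n - 1|) atTop (𝓝 0) := by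
      simpa using ((ha_lim.const_mul 2).sub_const 1).abs
    have e4 : Tendsto t atTop (𝓝 0) := by
      simpa [t] using (e1.add ((e2.const_mul 2).mul_const M)).const_mul 2
    have e5 : Tendsto (fun n => √(t n)) atTop (𝓝 0) := by simpa using e4.sqrt
    simpa using ((ha_lim.const_mul 2).mul (e5.const_mul (2 * √(B + 1)))).add (e3.mul_const L)
  have ev : ∀ᶠ n in atTop, τ n < m / 4 ∧ 1 / 4 < a n ∧ a n < 1 ∧ |b n| < 1 :=
    (hτ.eventually_lt_const (by positivity)).and
      ((ha_lim.eventually_const_lt (by norm_num)).and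
        ((ha_lim.eventually_lt_const (by norm_num)).and
          (hb_lim.abs.eventually_lt_const (by norm_num))))
  obtain ⟨N, hN⟩ := eventually_atTop.1 ev
  have near : ∀ n, N ≤ n → ∀ z ∈ K, ‖scaledRoot a b s n z - sqrtEdge s z‖ ≤ m / 4 := by
    intro n hn z hz
    obtain ⟨q1, q2, q3, q4⟩ := hN n hn
    have hz' := hM z hz
    have ha0 : (a n : ℂ) ≠ 0 := by exact_mod_cast (ha n).ne'
    have hna : ‖(2 * a n : ℂ)‖ = 2 * a n := by
      rw [norm_mul, Complex.norm_real, Real.norm_of_nonneg (ha n).le]; simp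
    have hwB : ‖(z - b n) / (2 * a n)‖ ≤ B := by
      rw [norm_div, hna, div_le_iff₀ (by linarith)]
      calc ‖z - b n‖ ≤ ‖z‖ + ‖(b n : ℂ)‖ := norm_sub_le _ _
        _ ≤ M + 1 := by
          rw [Complex.norm_real, Real.norm_eq_abs]; linarith
        _ ≤ B * (2 * a n) := by rw [hB]; nlinarith
    have hdist : ‖(z - b n) / (2 * a n) - z‖ ≤ t n := by
      have e1 : (z - b n) / (2 * a n) - z
          = (-(b n : ℂ) - 2 * ((a n - 1 / 2 : ℝ) : ℂ) * z) / (2 * a n) := by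
        push_cast; field_simp; ring
      rw [e1, norm_div, hna, div_le_iff₀ (by linarith)]
      have e2 : ‖-(b n : ℂ) - 2 * ((a n - 1 / 2 : ℝ) : ℂ) * z‖
          ≤ |b n| + 2 * |a n - 1 / 2| * M := by
        refine (norm_sub_le _ _).trans ?_
        rw [norm_neg, norm_mul, norm_mul, Complex.norm_real, Complex.norm_real, Real.norm_eq_abs,
          Real.norm_eq_abs, RCLike.norm_ofNat]
        gcongr
      have e3 : 0 ≤ |b n| + 2 * |a n - 1 / 2| * M := by positivity
      simp only [t]
      nlinarith
    have hroot := norm_sqrtEdge_sub_le (shifted_mem_closedHalf (hKs hz) (ha n) (b n)) (hKs hz)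
      hwB (hz'.trans (by linarith))
    have e1 : scaledRoot a b s n z - sqrtEdge s z
        = 2 * a n * (sqrtEdge s ((z - b n) / (2 * a n)) - sqrtEdge s z)
          + ((2 * a n - 1 : ℝ) : ℂ) * sqrtEdge s z := by
      rw [scaledRoot]; push_cast; ring
    rw [e1]
    refine (norm_add_le _ _).trans (le_trans ?_ q1.le)
    rw [norm_mul, hna, norm_mul, Complex.norm_real, Real.norm_eq_abs]
    have := ha n
    simp only [τ]
    gcongr
    · exact hroot.trans (by gcongr)
    · exact hL z hz
  refine ⟨N, 2 * E, (2 * M + 10) * E, fun n hn z hz => ?_⟩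
  have n1 := near n hn z hz
  have n2 := near (n + 1) (by omega) z hz
  have hms := hmS z hz
  set S := sqrtEdge s z with hSdef
  set x := scaledRoot a b s n z with hx
  set y := scaledRoot a b s (n + 1) z with hy
  have hxlow : m / 2 ≤ ‖x‖ := by
    have e1 := norm_sub_norm_le S x
    rw [norm_sub_rev] at e1
    linarith
  refine ⟨norm_pos_iff.1 (by linarith), ?_, ?_⟩
  · rw [norm_inv]
    calc ‖x‖⁻¹ ≤ (m / 2)⁻¹ := by gcongr
      _ = 2 * E := by rw [hm, inv_div, div_inv_eq_mul]
  -- Both roots are within `m / 4` of the same number `S`, so their sum stays away from zero. Then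
  -- `y - x = (y² - x²) / (x + y)`, and the squares are polynomials in the coefficients: the
  -- increment is Lipschitz in `a`, `b`, although the root itself was only shown to be Hölder.
  · have hsum : m ≤ ‖x + y‖ := by
      have e1 : 2 * S = (x + y) - ((x - S) + (y - S)) := by ring
      have e2 : ‖2 * S‖ ≤ ‖x + y‖ + (m / 4 + m / 4) := by
        rw [e1]
        exact (norm_sub_le _ _).trans
          (by gcongr; exact (norm_add_le _ _).trans (by gcongr))
      rw [norm_mul, RCLike.norm_ofNat] at e2
      linarith
    obtain ⟨-, q2, q3, q4⟩ := hN n hn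
    obtain ⟨-, r2, r3, r4⟩ := hN (n + 1) (by omega)
    have hprod : (y - x) * (x + y) = ((b n - b (n + 1) : ℝ) : ℂ) * (2 * z - b n - b (n + 1))
        - 4 * ((a (n + 1) - a n : ℝ) : ℂ) * ((a (n + 1) + a n : ℝ) : ℂ) := by
      push_cast
      linear_combination scaledRoot_sq ha s (n + 1) z (b := b) - scaledRoot_sq ha s n z (b := b)
    have hnum : ‖(y - x) * (x + y)‖
        ≤ (2 * M + 10) * (|a (n + 1) - a n| + |b (n + 1) - b n|) := by
      rw [hprod]
      refine (norm_sub_le _ _).trans ?_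
      rw [norm_mul, norm_mul, norm_mul, Complex.norm_real, Complex.norm_real, Complex.norm_real,
        Real.norm_eq_abs, Real.norm_eq_abs, Real.norm_eq_abs, RCLike.norm_ofNat,
        abs_sub_comm (b n)]
      have e1 : ‖2 * z - b n - b (n + 1)‖ ≤ 2 * M + 2 := by
        refine (norm_sub_le _ _).trans ?_
        have := norm_sub_le (2 * z) (b n : ℂ)
        rw [norm_mul, RCLike.norm_ofNat, Complex.norm_real, Real.norm_eq_abs] at this
        rw [Complex.norm_real, Real.norm_eq_abs]
        linarith [hM z hz]
      have e2 : |a (n + 1) + a n| ≤ 2 := by rw [abs_of_pos] <;> linarith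
      calc |b (n + 1) - b n| * ‖2 * z - b n - b (n + 1)‖
            + 4 * |a (n + 1) - a n| * |a (n + 1) + a n|
          ≤ |b (n + 1) - b n| * (2 * M + 2) + 4 * |a (n + 1) - a n| * 2 := by gcongr
        _ ≤ _ := by nlinarith [abs_nonneg (a (n + 1) - a n), abs_nonneg (b (n + 1) - b n)]
    rw [norm_mul] at hnum
    have e3 : ‖y - x‖ * m ≤ (2 * M + 10) * (|a (n + 1) - a n| + |b (n + 1) - b n|) :=
      (by gcongr : ‖y - x‖ * m ≤ ‖y - x‖ * ‖x + y‖).trans hnum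
    rw [hm, mul_inv_le_iff₀ hE0] at e3
    linarith

/-! ### Jost solutions on compact sets -/

/-- A second order recursion that can be solved backwards extends from `n ≥ N` to all `n`. -/
theorem exists_backward_extension {A : Type*} {E : ℕ → A → A → A → Prop}
    (hE : ∀ n x y, ∃ w, E n w x y) (N : ℕ) (G : ℕ → A)
    (hG : ∀ n, N ≤ n → E n (G n) (G (n + 1)) (G (n + 2))) :
    ∃ F : ℕ → A, (∀ n, E n (F n) (F (n + 1)) (F (n + 2))) ∧ ∀ n, N ≤ n → F n = G n := by
  induction N generalizing G with
  | zero => exact ⟨G, fun n => hG n (Nat.zero_le n), fun _ _ => rfl⟩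
  | succ N ih =>
    obtain ⟨w, hw⟩ := hE N (G (N + 1)) (G (N + 2))
    obtain ⟨F, hF, hFG⟩ := ih (Function.update G N w) (fun n hn => by
      rcases hn.eq_or_lt with rfl | hn
      · simpa [Function.update] using hw
      · have h0 : n ≠ N := by omega
        have h1 : n + 1 ≠ N := by omega
        have h2 : n + 2 ≠ N := by omega
        simpa [Function.update, h0, h1, h2] using hG n hn)
    refine ⟨F, hF, fun n hn => ?_⟩
    have h0 : n ≠ N := by omega
    rw [hFG n (by omega)]
    simp [h0]

theorem exists_uniform_bound_of_tail {X : Type*} {r : ℕ → X → ℝ} (h : ∀ n, ∃ C, ∀ x, r n x ≤ C)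
    (htail : ∃ (N : ℕ) (C : ℝ), ∀ n, N ≤ n → ∀ x, r n x ≤ C) : ∃ C, ∀ n x, r n x ≤ C := by
  choose c hc using h
  obtain ⟨N, C, hC⟩ := htail
  refine ⟨max C (∑ k ∈ Finset.range N, |c k|), fun n x => ?_⟩
  rcases le_or_gt N n with hn | hn
  · exact (hC n hn x).trans (le_max_left _ _)
  · refine ((hc n x).trans (le_abs_self _)).trans (le_trans ?_ (le_max_right _ _))
    exact Finset.single_le_sum (f := fun k => |c k|) (fun _ _ => abs_nonneg _)
      (Finset.mem_range.2 hn)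

/-- On a compact set without branch points, the Jost solutions form a continuous family bounded by
the Ansatz, and the polynomial solutions are bounded by its inverse. -/
theorem exists_jost_family {a b : ℕ → ℝ} (ha : ∀ n, 0 < a n)
    (ha_lim : Tendsto a atTop (𝓝 (1 / 2))) (hb_lim : Tendsto b atTop (𝓝 0))
    (h_var : Summable fun n => |a (n + 1) - a n| + |b (n + 1) - b n|)
    {s : Side} {K : Set ℂ} (hK : IsCompact K) (hKs : K ⊆ s.closedHalf) (h1 : (1 : ℂ) ∉ K)
    (h2 : (-1 : ℂ) ∉ K) :
    ∃ F : ℕ → C(K, ℂ), (∀ z : K, IsJostSolution a b s z fun n => F n z) ∧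
      (∃ C : ℝ, ∀ (n : ℕ) (z : K), ‖F (n + 1) z / q a b s n z‖ ≤ C) ∧
      ∃ C : ℝ, ∀ (n : ℕ) (z : K), ‖P a b n z * q a b s n z‖ ≤ C := by
  have : CompactSpace K := isCompact_iff_compactSpace.1 hK
  have hcont : ∀ {g : ℂ → ℂ}, ContinuousOn g s.closedHalf → Continuous fun z : K => g z :=
    fun {g} hg => continuousOn_iff_continuous_domRestrict.1 (hg.mono hKs)
  have ha0 : ∀ n, (a n : ℂ) ≠ 0 := fun n => by exact_mod_cast (ha n).ne'
  obtain ⟨N, D, C, hN⟩ := exists_scaledRoot_bounds ha ha_lim hb_lim hK hKs h1 h2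
  -- The recursion is started at `N`, beyond which the scaled roots are invertible on `K`; `q` keeps
  -- its earlier factors, which only multiply the solution.
  let α : ℕ → C(K, ℂ) := fun n => ContinuousMap.const K (a (N + n) : ℂ)
  let c : ℕ → C(K, ℂ) := fun n => ⟨fun z => z - b (N + n), by fun_prop⟩
  let ζ : ℕ → C(K, ℂ) := fun n => ⟨fun z => zeta s ((z - b (N + n)) / (2 * a (N + n))),
    hcont (continuousOn_shifted ha (continuousOn_zeta s) _)⟩
  let η : ℕ → C(K, ℂ) := fun n => ⟨fun z => (z - b (N + n)) / (2 * a (N + n))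
      + sqrtEdge s ((z - b (N + n)) / (2 * a (N + n))),
    hcont (continuousOn_shifted ha (continuousOn_id.add (continuousOn_sqrtEdge s)) _)⟩
  let d : ℕ → C(K, ℂ) := fun n => ⟨fun z => (scaledRoot a b s (N + n) z)⁻¹,
    (hcont (continuousOn_scaledRoot ha s _)).inv₀ fun z => (hN _ (by omega) z z.2).1⟩
  let Q : ℕ → C(K, ℂ) := fun n => ⟨fun z => q a b s (N + n) z, hcont (continuousOn_q ha s _)⟩
  let p : ℕ → C(K, ℂ) := fun n => ⟨fun z => P a b (N + n) z,
    (continuous_polySeq a b (N + n + 1)).comp continuous_subtype_val⟩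
  set ε : ℕ → ℝ := fun n =>
    (1 / 2 + C / 2) * (|a (N + n + 1) - a (N + n)| + |b (N + n + 1) - b (N + n)|) with hεdef
  have hε : Summable ε := by
    refine Summable.mul_left _ ?_
    have := (summable_nat_add_iff N).2 h_var
    simpa only [add_comm _ N, add_assoc] using this
  have hζη : ∀ n, ζ n * η n = 1 := fun n => by
    ext z; exact zeta_mul_add s _
  have hc : ∀ n, α n * (ζ n + η n) = c n := fun n => by
    ext z
    simp only [α, ζ, η, c, zeta, ContinuousMap.mul_apply, ContinuousMap.add_apply,
      ContinuousMap.const_apply, ContinuousMap.coe_mk]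
    have := ha0 (N + n)
    field_simp
    ring
  have hd : ∀ n, α n * (η n - ζ n) * d n = 1 := fun n => by
    ext z
    have h3 := (hN (N + n) (by omega) z z.2).1
    have h4 : (α n * (η n - ζ n)) z = scaledRoot a b s (N + n) z := by
      simp only [α, ζ, η, zeta, scaledRoot, ContinuousMap.mul_apply, ContinuousMap.sub_apply,
        ContinuousMap.const_apply, ContinuousMap.coe_mk]
      ring
    rw [ContinuousMap.mul_apply, h4]
    exact mul_inv_cancel₀ h3
  have hQ : ∀ n, Q (n + 1) = ζ n * Q n := fun n => by
    ext z; exact q_succ a b s (N + n) z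
  have hζ1 : ∀ n, ‖ζ n‖ ≤ 1 := fun n => (ContinuousMap.norm_le _ zero_le_one).2 fun z =>
    norm_zeta_le_one (shifted_mem_closedHalf (hKs z.2) (ha _) _)
  have hD : ∀ n, ‖d n‖ ≤ max D 0 := fun n => (ContinuousMap.norm_le _ (le_max_right _ _)).2
    fun z => (hN (N + n) (by omega) z z.2).2.1.trans (le_max_left _ _)
  -- `a_n ζ_n` and `a_n η_n` equal half of `z - b_n` minus or plus the scaled root; `σ = ∓1` treats
  -- both increments together.
  have hρ : ∀ n (z : K) (σ : ℂ), ‖σ‖ = 1 →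
      ‖(-((b (N + n + 1) - b (N + n) : ℝ) : ℂ) + σ * (scaledRoot a b s (N + n + 1) z
        - scaledRoot a b s (N + n) z)) / 2‖ ≤ ε n := by
    intro n z σ hσ
    have h3 := (hN (N + n) (by omega) z z.2).2.2
    rw [norm_div, RCLike.norm_ofNat, div_le_iff₀ two_pos]
    refine (norm_add_le _ _).trans ?_
    rw [norm_neg, norm_mul, hσ, one_mul, Complex.norm_real, Real.norm_eq_abs]
    have := abs_nonneg (a (N + n + 1) - a (N + n))
    simp only [hεdef]
    linarith
  have hnorm : ∀ (g : C(K, ℂ)) (n : ℕ), (∀ z, ‖g z‖ ≤ ε n) → ‖g‖ ≤ |ε n| := fun g n hg =>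
    (ContinuousMap.norm_le _ (abs_nonneg _)).2 fun z => (hg z).trans (le_abs_self _)
  have hx : ∀ n, ‖α (n + 1) * ζ (n + 1) - α n * ζ n‖ ≤ |ε n| := fun n => hnorm _ _ fun z => by
    refine (congrArg norm ?_).trans_le (hρ n z (-1) (by simp))
    have e1 := ha0 (N + n)
    have e2 := ha0 (N + n + 1)
    simp only [α, ζ, zeta, scaledRoot, ContinuousMap.mul_apply, ContinuousMap.sub_apply,
      ContinuousMap.const_apply, ContinuousMap.coe_mk, ← add_assoc]
    push_cast
    field_simp
    ring
  have hy : ∀ n, ‖α (n + 1) * η (n + 1) - α n * η n‖ ≤ |ε n| := fun n => hnorm _ _ fun z => by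
    refine (congrArg norm ?_).trans_le (hρ n z 1 (by simp))
    have e1 := ha0 (N + n)
    have e2 := ha0 (N + n + 1)
    simp only [α, η, scaledRoot, ContinuousMap.mul_apply, ContinuousMap.sub_apply,
      ContinuousMap.const_apply, ContinuousMap.coe_mk, ← add_assoc]
    push_cast
    field_simp
    ring
  have hp : ∀ n, α n * p n + α (n + 1) * p (n + 2) = c (n + 1) * p (n + 1) := fun n => by
    ext z
    have := polySeq_solves (b := b) ha z (N + n + 1)
    simp only [aPrev] at this
    simp only [α, p, c, P, ContinuousMap.mul_apply, ContinuousMap.add_apply,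
      ContinuousMap.const_apply, ContinuousMap.coe_mk, ← add_assoc]
    linear_combination this
  obtain ⟨u, hu, hueq⟩ := exists_solution_asymptotic_ansatz hζη hc hd hQ hζ1 hD hε.abs hx hy
  obtain ⟨Cp, hCp⟩ := exists_bound_mul_ansatz hζη hc hd hQ hζ1 hD hε.abs hx hy hp
  let Id : C(K, ℂ) := ⟨fun z => z, by fun_prop⟩
  -- `F (n + 1)` stands for `f_n`, so the tail `Q k * u k`, which is `f_{N+k}`, occupies the indices
  -- from `N + 1` on; division by `aPrev a n` continues it down to `f_{-1}`.
  obtain ⟨F, hF, hFG⟩ := exists_backward_extension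
    (E := fun n (w x y : C(K, ℂ)) => (aPrev a n : ℂ) • w + (b n : ℂ) • x + (a n : ℂ) • y = Id * x)
    (fun n x y => ⟨(aPrev a n : ℂ)⁻¹ • (Id * x - (b n : ℂ) • x - (a n : ℂ) • y), by
      rw [smul_inv_smul₀ (by exact_mod_cast (aPrev_pos ha n).ne')]; ring⟩) (N + 1)
    (fun n => Q (n - (N + 1)) * u (n - (N + 1))) (fun n hn => by
      obtain ⟨k, rfl⟩ := Nat.exists_eq_add_of_le hn
      have i1 : N + 1 + k - (N + 1) = k := by omega
      have i2 : N + 1 + k + 1 - (N + 1) = k + 1 := by omega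
      have i3 : N + 1 + k + 2 - (N + 1) = k + 2 := by omega
      rw [i1, i2, i3]
      ext z
      have e1 := congrArg (fun g : C(K, ℂ) => g z) (hueq k)
      have i4 : N + 1 + k = N + k + 1 := by omega
      simp only [α, c, ContinuousMap.mul_apply, ContinuousMap.add_apply,
        ContinuousMap.const_apply, ContinuousMap.coe_mk, ← add_assoc] at e1
      simp only [i4, Id, aPrev, ContinuousMap.mul_apply, ContinuousMap.add_apply,
        ContinuousMap.smul_apply, ContinuousMap.coe_mk, smul_eq_mul]
      linear_combination e1)
  have hFu : ∀ k (z : K), F (N + k + 1) z / q a b s (N + k) z = u k z := by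
    intro k z
    rw [hFG _ (by omega)]
    have i1 : N + k + 1 - (N + 1) = k := by omega
    rw [i1]
    exact mul_div_cancel_left₀ _ (q_ne_zero a b s (N + k) z)
  refine ⟨F, fun z => ⟨fun n => ?_, ?_⟩, ?_, ?_⟩
  · have := congrArg (fun g : C(K, ℂ) => g z) (hF n)
    simpa [Id] using this
  · rw [← tendsto_add_atTop_iff_nat N]
    have h3 : Tendsto (fun k => u k z) atTop (𝓝 1) :=
      ((continuous_eval_const (F := C(K, ℂ)) z).tendsto _).comp hu
    refine h3.congr fun k => ?_
    rw [add_comm k N]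
    exact (hFu k z).symm
  · refine exists_uniform_bound_of_tail (r := fun n (z : K) => ‖F (n + 1) z / q a b s n z‖)
      (fun n => ?_) ?_
    · have hg : Continuous fun z : K => F (n + 1) z / q a b s n z :=
        (F (n + 1)).continuous.div (hcont (continuousOn_q ha s n))
          fun z => q_ne_zero a b s n z
      exact ⟨‖(⟨_, hg⟩ : C(K, ℂ))‖, fun z => ContinuousMap.norm_coe_le_norm ⟨_, hg⟩ z⟩
    · obtain ⟨Cu, hCu⟩ := hu.norm.bddAbove_range
      refine ⟨N, Cu, fun n hn z => ?_⟩
      obtain ⟨k, rfl⟩ := Nat.exists_eq_add_of_le hn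
      simp only [hFu]
      exact ((u k).norm_coe_le_norm z).trans (hCu ⟨k, rfl⟩)
  · refine exists_uniform_bound_of_tail (r := fun n (z : K) => ‖P a b n z * q a b s n z‖)
      (fun n => ?_) ⟨N, Cp, fun n hn z => ?_⟩
    · have hg : Continuous fun z : K => P a b n z * q a b s n z :=
        ((continuous_polySeq a b (n + 1)).comp continuous_subtype_val).mul
          (hcont (continuousOn_q ha s n))
      exact ⟨‖(⟨_, hg⟩ : C(K, ℂ))‖, fun z => ContinuousMap.norm_coe_le_norm ⟨_, hg⟩ z⟩
    · obtain ⟨k, rfl⟩ := Nat.exists_eq_add_of_le hn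
      exact ((p k * Q k).norm_coe_le_norm z).trans (hCp k)

/-! ### Solutions of the Jacobi equation -/

theorem SolvesJacobi.eq_of_init {a b : ℕ → ℝ} (ha : ∀ n, 0 < a n) {z : ℂ} {F G : ℕ → ℂ}
    (hF : SolvesJacobi a b z F) (hG : SolvesJacobi a b z G) (h0 : F 0 = G 0) (h1 : F 1 = G 1) :
    F = G := by
  have key : ∀ n, F n = G n ∧ F (n + 1) = G (n + 1) := by
    intro n
    induction n with
    | zero => exact ⟨h0, h1⟩
    | succ n ih =>
      refine ⟨ih.2, ?_⟩
      have h : (a n : ℂ) ≠ 0 := by exact_mod_cast (ha n).ne'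
      have e1 := hF n
      have e2 := hG n
      rw [ih.1, ih.2] at e1
      exact mul_left_cancel₀ h (by linear_combination e1 - e2)
  exact funext fun n => (key n).1

theorem SolvesJacobi.const_mul {a b : ℕ → ℝ} {z : ℂ} {F : ℕ → ℂ} (hF : SolvesJacobi a b z F)
    (c : ℂ) : SolvesJacobi a b z fun n => c * F n := fun n => by
  linear_combination c * hF n

theorem solvesJacobi_zero (a b : ℕ → ℝ) (z : ℂ) : SolvesJacobi a b z 0 := fun n => by simp

/-- Solutions with zero Wronskian are linearly dependent. -/
theorem SolvesJacobi.exists_eq_mul {a b : ℕ → ℝ} (ha : ∀ n, 0 < a n) {z : ℂ} {F G : ℕ → ℂ}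
    (hF : SolvesJacobi a b z F) (hG : SolvesJacobi a b z G) (hF0 : F ≠ 0)
    (hW : wronskian a F G 0 = 0) : ∃ c : ℂ, ∀ n, G n = c * F n := by
  have hW' : F 0 * G 1 = F 1 * G 0 := by
    simp only [wronskian, aPrev] at hW
    have : F 0 * G 1 - F 1 * G 0 = 0 := by
      simpa using hW
    linear_combination this
  by_cases h0 : F 0 = 0
  · have h1 : F 1 ≠ 0 := fun h1 =>
      hF0 (hF.eq_of_init ha (solvesJacobi_zero a b z) h0 h1)
    refine ⟨G 1 / F 1, congrFun (hG.eq_of_init ha (hF.const_mul _) ?_ ?_)⟩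
    · rw [h0, zero_mul] at hW'
      rw [h0, mul_zero]
      exact (mul_eq_zero.1 hW'.symm).resolve_left h1
    · field_simp
  · refine ⟨G 0 / F 0, congrFun (hG.eq_of_init ha (hF.const_mul _) ?_ ?_)⟩
    · field_simp
    · field_simp
      linear_combination hW'

theorem IsJostSolution.ne_zero {a b : ℕ → ℝ} {s : Side} {z : ℂ} {F : ℕ → ℂ}
    (hF : IsJostSolution a b s z F) : F ≠ 0 := by
  rintro rfl
  have := hF.2
  simp only [Pi.zero_apply, zero_div] at this
  exact zero_ne_one (tendsto_nhds_unique tendsto_const_nhds this)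

/-- The Wronskian of two Jost solutions is `q_n q_{n+1}` times a null sequence, hence zero because
`|q_n| ≤ 1`. They are therefore proportional, and the asymptotics fix the factor at `1`. On the cut
this uses the full normalization, since neither solution need decay. -/
theorem IsJostSolution.unique {a b : ℕ → ℝ} (ha : ∀ n, 0 < a n)
    (ha_lim : Tendsto a atTop (𝓝 (1 / 2))) {s : Side} {z : ℂ} (hz : z ∈ s.closedHalf)
    {F G : ℕ → ℂ} (hF : IsJostSolution a b s z F) (hG : IsJostSolution a b s z G) : F = G := by
  have hne : ∀ n, q a b s n z ≠ 0 := fun n => q_ne_zero a b s n z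
  have hW : wronskian a F G 0 = 0 := by
    have hlim : Tendsto (fun n => wronskian a F G (n + 1)) atTop (𝓝 0) := by
      have e1 : Tendsto (fun n => F (n + 1) / q a b s n z * (G (n + 2) / q a b s (n + 1) z)
          - F (n + 2) / q a b s (n + 1) z * (G (n + 1) / q a b s n z)) atTop (𝓝 0) := by
        have := (hF.2.mul ((tendsto_add_atTop_iff_nat 1).2 hG.2)).sub
          (((tendsto_add_atTop_iff_nat 1).2 hF.2).mul hG.2)
        simpa using this
      have e2 : Tendsto (fun n => a n * ‖F (n + 1) / q a b s n z
          * (G (n + 2) / q a b s (n + 1) z)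
          - F (n + 2) / q a b s (n + 1) z * (G (n + 1) / q a b s n z)‖) atTop (𝓝 0) := by
        simpa using ha_lim.mul e1.norm
      refine squeeze_zero_norm (fun n => ?_) e2
      have e3 : wronskian a F G (n + 1) = q a b s n z * q a b s (n + 1) z * (a n *
          (F (n + 1) / q a b s n z * (G (n + 2) / q a b s (n + 1) z)
          - F (n + 2) / q a b s (n + 1) z * (G (n + 1) / q a b s n z))) := by
        have := hne n
        have := hne (n + 1)
        simp only [wronskian, aPrev]
        field_simp
      rw [e3, norm_mul, norm_mul, norm_mul (a n : ℂ), Complex.norm_real,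
        Real.norm_of_nonneg (ha n).le]
      refine mul_le_of_le_one_left (mul_nonneg (ha n).le (norm_nonneg _)) ?_
      exact mul_le_one₀ (norm_q_le_one ha hz n) (norm_nonneg _) (norm_q_le_one ha hz _)
    simp only [wronskian_eq hF.1 hG.1] at hlim
    exact tendsto_nhds_unique tendsto_const_nhds hlim
  obtain ⟨c, hc⟩ := hF.1.exists_eq_mul ha hG.1 hF.ne_zero hW
  have hc1 : c = 1 := by
    refine tendsto_nhds_unique ?_ hG.2
    have := hF.2.const_mul c
    rw [mul_one] at this
    refine this.congr fun n => ?_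
    rw [hc, mul_div_assoc]
  funext n
  rw [hc, hc1, one_mul]

theorem polySeq_ne_zero (a b : ℕ → ℝ) (z : ℂ) : polySeq a b z ≠ 0 := fun h => by
  have := congrFun h 1
  simp [polySeq] at this

/-! ### Existence, continuity and decay of Jost solutions, and `Ω` on the cut. -/

section Jost

variable {a b : ℕ → ℝ} {s : Side}

theorem existsUnique_jost (ha : ∀ n, 0 < a n)
    (ha_lim : Tendsto a atTop (𝓝 (1 / 2))) (hb_lim : Tendsto b atTop (𝓝 0))
    (h_var : Summable fun n => |a (n + 1) - a n| + |b (n + 1) - b n|)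
    {z : ℂ} (hz : z ∈ s.closedHalf) (h1 : z ≠ 1) (h2 : z ≠ -1) :
    ∃! F : ℕ → ℂ, IsJostSolution a b s z F := by
  obtain ⟨F, hF, -⟩ := exists_jost_family ha ha_lim hb_lim h_var (isCompact_singleton (x := z))
    (singleton_subset_iff.2 hz) (fun h => h1 h.symm) (fun h => h2 h.symm)
  exact ⟨_, hF ⟨z, rfl⟩, fun G hG => hG.unique ha ha_lim hz (hF ⟨z, rfl⟩)⟩

theorem IsJostSolution.jostSeq_eq (ha : ∀ n, 0 < a n)
    (ha_lim : Tendsto a atTop (𝓝 (1 / 2))) {z : ℂ} (hz : z ∈ s.closedHalf) {F : ℕ → ℂ}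
    (hF : IsJostSolution a b s z F) : jostSeq a b s z = F := by
  have h : ∃ F, IsJostSolution a b s z F := ⟨F, hF⟩
  rw [jostSeq, dif_pos h]
  exact h.choose_spec.unique ha ha_lim hz hF

theorem isJostSolution_jostSeq (ha : ∀ n, 0 < a n)
    (ha_lim : Tendsto a atTop (𝓝 (1 / 2))) (hb_lim : Tendsto b atTop (𝓝 0))
    (h_var : Summable fun n => |a (n + 1) - a n| + |b (n + 1) - b n|)
    {z : ℂ} (hz : z ∈ s.closedHalf) (h1 : z ≠ 1) (h2 : z ≠ -1) :
    IsJostSolution a b s z (jostSeq a b s z) := by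
  obtain ⟨F, hF, -⟩ := existsUnique_jost ha ha_lim hb_lim h_var hz h1 h2
  rwa [hF.jostSeq_eq ha ha_lim hz]

/-- Uniqueness identifies the pointwise choice `jostSeq` with the continuous family constructed on a
compact neighbourhood. -/
theorem continuousOn_jostSeq (ha : ∀ n, 0 < a n)
    (ha_lim : Tendsto a atTop (𝓝 (1 / 2))) (hb_lim : Tendsto b atTop (𝓝 0))
    (h_var : Summable fun n => |a (n + 1) - a n| + |b (n + 1) - b n|) (n : ℕ) :
    ContinuousOn (fun z => jostSeq a b s z n) (s.closedHalf \ {1, -1}) := by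
  intro z hz
  have hopen : IsOpen ({1, -1} : Set ℂ)ᶜ := (toFinite _).isClosed.isOpen_compl
  obtain ⟨r, hr, hrK⟩ := Metric.nhds_basis_closedBall.mem_iff.1 (hopen.mem_nhds hz.2)
  set K := Metric.closedBall z r ∩ s.closedHalf with hKdef
  have hK : IsCompact K := (isCompact_closedBall z r).inter_right (isClosed_closedHalf s)
  obtain ⟨F, hF, -⟩ := exists_jost_family ha ha_lim hb_lim h_var hK inter_subset_right
    (fun h => hrK h.1 (by simp)) (fun h => hrK h.1 (by simp))
  have hcont : ContinuousOn (fun z => jostSeq a b s z n) K := by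
    rw [continuousOn_iff_continuous_domRestrict]
    refine (F n).continuous.congr fun x => ?_
    exact (congrFun ((hF x).jostSeq_eq ha ha_lim x.2.2) n).symm
  refine (hcont z ⟨Metric.mem_closedBall_self hr.le, hz.1⟩).mono_of_mem_nhdsWithin ?_
  exact inter_mem (nhdsWithin_le_nhds (Metric.closedBall_mem_nhds z hr))
    (mem_of_superset self_mem_nhdsWithin sdiff_subset)

theorem Omega_eq (a b : ℕ → ℝ) (s : Side) (z : ℂ) :
    Omega a b s z = -(1 / 2) * jostSeq a b s z 0 := by
  simp [Omega, wronskian, aPrev, polySeq]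

theorem continuousOn_Omega (ha : ∀ n, 0 < a n)
    (ha_lim : Tendsto a atTop (𝓝 (1 / 2))) (hb_lim : Tendsto b atTop (𝓝 0))
    (h_var : Summable fun n => |a (n + 1) - a n| + |b (n + 1) - b n|) :
    ContinuousOn (Omega a b s) (s.closedHalf \ {1, -1}) := by
  have h := (continuousOn_jostSeq (s := s) ha ha_lim hb_lim h_var 0).const_mul (-(1 / 2) : ℂ)
  exact h.congr fun z _ => Omega_eq a b s z

theorem one_mem_cut : (1 : ℂ) ∈ cut := ⟨1, by norm_num, by simp⟩

theorem neg_one_mem_cut : (-1 : ℂ) ∈ cut := ⟨-1, by norm_num, by simp⟩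

/-- Outside `[-1, 1]` the Ansatz decays exponentially. -/
theorem summable_norm_q (ha : ∀ n, 0 < a n) (ha_lim : Tendsto a atTop (𝓝 (1 / 2)))
    (hb_lim : Tendsto b atTop (𝓝 0)) {z : ℂ} (hz : z ∈ s.closedHalf) (hc : z ∉ cut) :
    Summable fun n => ‖q a b s n z‖ := by
  have hlim : Tendsto (fun n => ‖zeta s ((z - b n) / (2 * a n))‖) atTop (𝓝 ‖zeta s z‖) := by
    refine (Tendsto.comp (continuousOn_zeta s z hz) ?_).norm
    exact tendsto_nhdsWithin_iff.2 ⟨tendsto_shifted ha_lim hb_lim z,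
      Eventually.of_forall fun n => shifted_mem_closedHalf hz (ha n) _⟩
  obtain ⟨r, hr1, hr2⟩ := exists_between (norm_zeta_lt_one hz hc)
  refine summable_of_ratio_norm_eventually_le hr2 ?_
  filter_upwards [hlim.eventually_lt_const hr1] with n hn
  rw [norm_norm, norm_norm, q_succ, norm_mul]
  gcongr

theorem memℓp_jostSeq (ha : ∀ n, 0 < a n) (ha_lim : Tendsto a atTop (𝓝 (1 / 2)))
    (hb_lim : Tendsto b atTop (𝓝 0)) {z : ℂ} (hz : z ∈ s.closedHalf) (hc : z ∉ cut)
    {F : ℕ → ℂ} (hF : IsJostSolution a b s z F) : Memℓp (fun n => F (n + 1)) 2 := by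
  obtain ⟨C, hC⟩ := hF.2.norm.bddAbove_range
  have hC' : ∀ n, ‖F (n + 1)‖ ≤ C * ‖q a b s n z‖ := fun n => by
    have h : ‖F (n + 1) / q a b s n z‖ ≤ C := hC ⟨n, rfl⟩
    rwa [norm_div, div_le_iff₀ (norm_pos_iff.2 (q_ne_zero a b s n z))] at h
  have hC0 : 0 ≤ C := (norm_nonneg _).trans (hC ⟨0, rfl⟩)
  refine memℓp_gen ?_
  simp only [ENNReal.toReal_ofNat, Real.rpow_ofNat]
  refine Summable.of_nonneg_of_le (fun n => by positivity) (fun n => ?_)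
    ((summable_norm_q ha ha_lim hb_lim hz hc).mul_left (C ^ 2))
  calc ‖F (n + 1)‖ ^ 2 ≤ (C * ‖q a b s n z‖) ^ 2 := by gcongr; exact hC' n
    _ = C ^ 2 * (‖q a b s n z‖ * ‖q a b s n z‖) := by ring
    _ ≤ C ^ 2 * ‖q a b s n z‖ := by
      gcongr
      exact mul_le_of_le_one_left (norm_nonneg _) (norm_q_le_one ha hz n)

theorem polySeq_conj (a b : ℕ → ℝ) (z : ℂ) (n : ℕ) :
    polySeq a b (conj z) n = conj (polySeq a b z n) := by
  induction n using Nat.strong_induction_on with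
  | _ n ih =>
    match n with
    | 0 => simp [polySeq]
    | 1 => simp [polySeq]
    | n + 2 =>
      simp only [polySeq]
      rw [ih (n + 1) (by omega), ih n (by omega)]
      simp

/-- On `(-1, 1)` the ratios `f_{n+1} / f_n` have a non-real limit, so that the Jost solution is not
a multiple of the real solution `P_n`. -/
theorem Omega_ne_zero_of_mem_Ioo (ha : ∀ n, 0 < a n)
    (ha_lim : Tendsto a atTop (𝓝 (1 / 2))) (hb_lim : Tendsto b atTop (𝓝 0))
    (h_var : Summable fun n => |a (n + 1) - a n| + |b (n + 1) - b n|)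
    {x : ℝ} (hx : x ∈ Ioo (-1 : ℝ) 1) : Omega a b s x ≠ 0 := by
  intro h0
  have hz : (x : ℂ) ∈ s.closedHalf := by cases s <;> simp [Side.closedHalf]
  have hF := isJostSolution_jostSeq ha ha_lim hb_lim h_var hz
    (by exact_mod_cast hx.2.ne) (by exact_mod_cast hx.1.ne')
  obtain ⟨c, hc⟩ := (polySeq_solves ha _).exists_eq_mul ha hF.1 (polySeq_ne_zero a b x) h0
  set F := jostSeq a b s x
  have hlimζ : Tendsto (fun n => zeta s (((x : ℂ) - b n) / (2 * a n))) atTop (𝓝 (zeta s x)) := by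
    refine Tendsto.comp (continuousOn_zeta s x hz) ?_
    exact tendsto_nhdsWithin_iff.2 ⟨tendsto_shifted ha_lim hb_lim x,
      Eventually.of_forall fun n => shifted_mem_closedHalf hz (ha n) _⟩
  have hratio : Tendsto (fun n => F (n + 2) / F (n + 1)) atTop (𝓝 (zeta s x)) := by
    have h1 := (((tendsto_add_atTop_iff_nat 1).2 hF.2).div hF.2 one_ne_zero).mul hlimζ
    rw [div_one, one_mul] at h1
    refine h1.congr fun n => ?_
    have e1 := q_ne_zero a b s n x
    have e2 := zeta_ne_zero s (((x : ℂ) - b n) / (2 * a n))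
    simp only [Pi.div_apply]
    rw [q_succ, div_div_div_eq, div_mul_eq_mul_div]
    rw [show F (n + 1 + 1) * q a b s n x * zeta s (((x : ℂ) - b n) / (2 * a n))
      = (zeta s (((x : ℂ) - b n) / (2 * a n)) * q a b s n x) * F (n + 2) by ring,
      mul_div_mul_left _ _ (mul_ne_zero e2 e1)]
  -- The proportionality constant cancels, and the values of `P_n` at a real point are real. Where
  -- `F (n + 1) = 0` the quotient is `0`, which is real as well.
  have him : ∀ n, (F (n + 2) / F (n + 1)).im = 0 := by
    intro n
    have hreal : ∀ n, conj (polySeq a b x n) = polySeq a b x n := fun n => by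
      rw [← polySeq_conj, Complex.conj_ofReal]
    rw [← Complex.conj_eq_iff_im]
    have hc0 : c ≠ 0 := by
      rintro rfl
      exact hF.ne_zero (funext fun n => by rw [hc, zero_mul]; rfl)
    rw [hc, hc, mul_div_mul_left _ _ hc0, map_div₀, hreal, hreal]
  have h2 := (Complex.continuous_im.tendsto _).comp hratio
  simp only [Function.comp_def, him] at h2
  exact zeta_im_ne_zero s hx (tendsto_nhds_unique h2 tendsto_const_nhds)

end Jost

/-! ### Compact perturbations -/

theorem norm_weightedShift_le_of_bound {w : ℕ → ℂ} {C : ℝ} (hC : ∀ n, ‖w n‖ ≤ C) (k : ℕ) :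
    ‖weightedShift w k‖ ≤ C := by
  refine ContinuousLinearMap.opNorm_le_bound _ ((norm_nonneg _).trans (hC 0)) fun u => ?_
  have h : weightedShift w k u = ⟨fun n => w n * u (n + k), memlp_weightedShift hC k u⟩ := by
    ext n
    exact weightedShift_apply ⟨C, hC⟩ k u n
  rw [h]
  exact norm_weightedShift_le hC k u

theorem e_apply (n m : ℕ) : (e n : ℕ → ℂ) m = if m = n then 1 else 0 := by
  by_cases h : m = n
  · subst h; simp [e]
  · simp [e, lp.single_apply, h]

theorem exists_norm_bound_of_tendsto {w : ℕ → ℂ} {l : ℂ} (hw : Tendsto w atTop (𝓝 l)) :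
    ∃ C : ℝ, ∀ n, ‖w n‖ ≤ C := by
  obtain ⟨C, hC⟩ := hw.norm.bddAbove_range
  exact ⟨C, fun n => hC ⟨n, rfl⟩⟩

/-- The rank one operator `u ↦ (u, y) x`. -/
theorem isCompactOperator_smulRight (y x : Ell2) :
    IsCompactOperator ((innerSL ℂ y).smulRight x : Ell2 →L[ℂ] Ell2) := by
  have h : IsCompactOperator (innerSL ℂ y : Ell2 →L[ℂ] ℂ) :=
    isCompactOperator_of_locallyCompactSpace_dom _
  exact h.clm_comp (ContinuousLinearMap.toSpanSingleton ℂ x)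

/-- The finite rank truncations converge in norm: the remainder is diagonal, with entries from the
tail of `w`. -/
theorem isCompactOperator_diagonal {w : ℕ → ℂ} (hw : Tendsto w atTop (𝓝 0)) :
    IsCompactOperator (weightedShift w 0) := by
  let S : ℕ → Ell2 →L[ℂ] Ell2 := fun N =>
    ∑ k ∈ Finset.range N, w k • (innerSL ℂ (e k)).smulRight (e k)
  have hS : ∀ N, IsCompactOperator (S N) := by
    intro N
    simp only [S]
    induction N with
    | zero => simpa using isCompactOperator_zero
    | succ N ih =>
      rw [Finset.sum_range_succ]
      exact ih.add ((isCompactOperator_smulRight _ _).smul (w N))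
  have hwb := exists_norm_bound_of_tendsto hw
  have hSapply : ∀ N (u : Ell2) m, S N u m = if m < N then w m * u m else 0 := by
    intro N u m
    simp only [S, sum_apply, smul_apply,
      ContinuousLinearMap.smulRight_apply, innerSL_apply_apply, inner_e]
    rw [lp.coeFn_sum, Finset.sum_apply]
    simp [e_apply, Finset.sum_ite_eq]
  refine isCompactOperator_of_tendsto (F := S) (l := atTop) ?_ (Eventually.of_forall hS)
  rw [Metric.tendsto_atTop]
  intro δ hδ
  obtain ⟨N, hN⟩ := (Metric.tendsto_atTop.1 hw) (δ / 2) (by positivity)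
  refine ⟨N, fun n hn => ?_⟩
  let t : ℕ → ℂ := fun m => if m < n then 0 else w m
  have ht : ∀ m, ‖t m‖ ≤ δ / 2 := by
    intro m
    by_cases hm : m < n
    · simp only [t, if_pos hm, norm_zero]; positivity
    · simp only [t, if_neg hm]
      simpa using (hN m (by omega)).le
  have hdiff : weightedShift w 0 - S n = weightedShift t 0 := by
    ext u m
    rw [sub_apply, lp.coeFn_sub, Pi.sub_apply, hSapply,
      weightedShift_apply hwb, weightedShift_apply ⟨_, ht⟩]
    by_cases hm : m < n <;> simp [t, hm]
  rw [dist_comm, dist_eq_norm, hdiff]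
  linarith [norm_weightedShift_le_of_bound ht 0]

theorem adjoint_diagonal_ofReal {w : ℕ → ℝ} (hw : ∃ C : ℝ, ∀ n, ‖(w n : ℂ)‖ ≤ C) :
    ContinuousLinearMap.adjoint (weightedShift (fun n => (w n : ℂ)) 0)
      = weightedShift (fun n => (w n : ℂ)) 0 := by
  ext u n
  rw [adjoint_weightedShift_apply, weightedShift_apply hw]
  have h : weightedShift (fun n => (w n : ℂ)) 0 (e n) = (w n : ℂ) • e n := by
    ext m
    rw [weightedShift_apply hw, lp.coeFn_smul, Pi.smul_apply, add_zero, smul_eq_mul, e_apply]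
    split_ifs with hm
    · rw [hm]
    · simp
  rw [h, inner_smul_left, inner_e]
  simp

theorem isSelfAdjoint_jacobiOp (a : ℕ → ℝ) {b : ℕ → ℝ} (hb : ∃ C : ℝ, ∀ n, ‖(b n : ℂ)‖ ≤ C) :
    IsSelfAdjoint (jacobiOp a b) := by
  rw [jacobiOp]
  refine IsSelfAdjoint.add ?_ ?_
  · rw [← ContinuousLinearMap.star_eq_adjoint]
    exact IsSelfAdjoint.add_star_self _
  · rw [IsSelfAdjoint, ContinuousLinearMap.star_eq_adjoint, adjoint_diagonal_ofReal hb]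

theorem weightedShift_sub {v w : ℕ → ℂ} (hv : ∃ C : ℝ, ∀ n, ‖v n‖ ≤ C)
    (hw : ∃ C : ℝ, ∀ n, ‖w n‖ ≤ C) (k : ℕ) :
    weightedShift v k - weightedShift w k = weightedShift (fun n => v n - w n) k := by
  have h : ∃ C : ℝ, ∀ n, ‖v n - w n‖ ≤ C := by
    obtain ⟨C, hC⟩ := hv
    obtain ⟨D, hD⟩ := hw
    exact ⟨C + D, fun n => (norm_sub_le _ _).trans (add_le_add (hC n) (hD n))⟩
  ext u n
  rw [sub_apply, lp.coeFn_sub, Pi.sub_apply, weightedShift_apply hv,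
    weightedShift_apply hw, weightedShift_apply h]
  ring

theorem isCompactOperator_jacobiOp {a b : ℕ → ℝ} (ha : Tendsto a atTop (𝓝 0))
    (hb : Tendsto b atTop (𝓝 0)) : IsCompactOperator (jacobiOp a b) := by
  have hcast : ∀ {w : ℕ → ℝ}, Tendsto w atTop (𝓝 0) → Tendsto (fun n => (w n : ℂ)) atTop (𝓝 0) :=
    fun {w} hw => by simpa [Function.comp_def] using (Complex.continuous_ofReal.tendsto _).comp hw
  have hA := isCompactOperator_diagonal (hcast ha)
  have hab := exists_norm_bound_of_tendsto (hcast ha)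
  have h1 : ∃ C : ℝ, ∀ _ : ℕ, ‖(1 : ℂ)‖ ≤ C := ⟨‖(1 : ℂ)‖, fun _ => le_rfl⟩
  -- A weighted shift is the diagonal operator after the unweighted shift, so it and its adjoint
  -- inherit compactness.
  have hfac : weightedShift (fun n => (a n : ℂ)) 1
      = weightedShift (fun n => (a n : ℂ)) 0 ∘L weightedShift (fun _ => 1) 1 := by
    ext u n
    rw [ContinuousLinearMap.comp_apply, weightedShift_apply hab, weightedShift_apply hab,
      weightedShift_apply h1]
    simp
  rw [jacobiOp]
  refine IsCompactOperator.add (IsCompactOperator.add ?_ ?_) (isCompactOperator_diagonal (hcast hb))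
  · rw [hfac]
    exact hA.comp_clm _
  · rw [hfac, ContinuousLinearMap.adjoint_comp, adjoint_diagonal_ofReal hab]
    exact hA.clm_comp (ContinuousLinearMap.adjoint (weightedShift (fun _ => 1) 1))

theorem jacobiOp_sub {a b a' b' : ℕ → ℝ} (ha : ∃ C : ℝ, ∀ n, ‖(a n : ℂ)‖ ≤ C)
    (hb : ∃ C : ℝ, ∀ n, ‖(b n : ℂ)‖ ≤ C) (ha' : ∃ C : ℝ, ∀ n, ‖(a' n : ℂ)‖ ≤ C)
    (hb' : ∃ C : ℝ, ∀ n, ‖(b' n : ℂ)‖ ≤ C) :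
    jacobiOp a b - jacobiOp a' b' = jacobiOp (fun n => a n - a' n) fun n => b n - b' n := by
  simp only [jacobiOp, Complex.ofReal_sub]
  rw [← weightedShift_sub ha ha', ← weightedShift_sub hb hb', map_sub]
  abel

/-- The spectrum of the free Jacobi operator is contained in `[-1, 1]`. -/
theorem isUnit_free_sub {z : ℂ} (hz : z ∉ cut) :
    IsUnit (jacobiOp (fun _ => 1 / 2) (fun _ => 0) - z • (1 : Ell2 →L[ℂ] Ell2)) := by
  set J₀ := jacobiOp (fun _ => 1 / 2) (fun _ => 0) with hJ
  have : Nontrivial Ell2 := ⟨e 0, 0, fun h => by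
    have := congrFun (congrArg (fun u : Ell2 => (u : ℕ → ℂ)) h) 0
    simp [e_apply] at this⟩
  have hsa : IsSelfAdjoint J₀ := isSelfAdjoint_jacobiOp _ ⟨0, by simp⟩
  -- `1/2` from the shift and `1/2` from its adjoint. Together with the reality of the spectrum this
  -- yields exactly `[-1, 1]` as a bound.
  have hnorm : ‖J₀‖ ≤ 1 := by
    have h1 : ‖weightedShift (fun _ => (((1 / 2 : ℝ) : ℝ) : ℂ)) 1‖ ≤ 1 / 2 :=
      norm_weightedShift_le_of_bound (fun _ => by simp) 1
    have h2 : ‖weightedShift (fun _ => (((0 : ℝ) : ℝ) : ℂ)) 0‖ ≤ 0 :=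
      norm_weightedShift_le_of_bound (fun _ => by simp) 0
    rw [hJ, jacobiOp]
    refine (norm_add₃_le).trans ?_
    rw [LinearIsometryEquiv.norm_map]
    linarith
  by_contra h
  have hspec : z ∈ spectrum ℂ J₀ := by
    rw [spectrum.mem_iff, ← IsUnit.neg_iff, neg_sub, Algebra.algebraMap_eq_smul_one]
    exact h
  have h1 := hsa.mem_spectrum_eq_re hspec
  have h2 : ‖z‖ ≤ 1 := (spectrum.norm_le_norm_of_mem hspec).trans hnorm
  rw [h1, Complex.norm_real, Real.norm_eq_abs, abs_le] at h2
  exact hz ⟨z.re, h2, h1.symm⟩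

/-- Fredholm alternative. -/
theorem isUnit_add_of_isCompactOperator {A K : Ell2 →L[ℂ] Ell2} (hA : IsUnit A)
    (hK : IsCompactOperator K) (hinj : ∀ x, A x + K x = 0 → x = 0) : IsUnit (A + K) := by
  obtain ⟨U, rfl⟩ := hA
  set V : Ell2 →L[ℂ] Ell2 := ((U⁻¹ : (Ell2 →L[ℂ] Ell2)ˣ) : Ell2 →L[ℂ] Ell2) with hV
  have hUV : ∀ x, (U : Ell2 →L[ℂ] Ell2) (V x) = x := fun x => by
    rw [← mul_apply_eq_comp, hV, Units.mul_inv, one_apply_eq_self]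
  have hcomp : IsCompactOperator (V * K : Ell2 →L[ℂ] Ell2) := hK.clm_comp V
  -- `U + K = U (1 + U⁻¹ K)`; either `-1` is an eigenvalue of the compact operator `U⁻¹ K`, giving a
  -- kernel vector of `U + K`, or the second factor is invertible.
  rcases hcomp.hasEigenvalue_or_mem_resolventSet (neg_ne_zero.2 (one_ne_zero (α := ℂ))) with h | h
  · obtain ⟨x, hx⟩ := h.exists_hasEigenvector
    refine absurd (hinj x ?_) hx.2
    have h1 : V (K x) = (-1 : ℂ) • x := hx.apply_eq_smul
    have h2 := congrArg (U : Ell2 →L[ℂ] Ell2) h1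
    rw [hUV, map_smul, neg_one_smul] at h2
    rw [h2, add_neg_cancel]
  · rw [spectrum.mem_resolventSet_iff, ← IsUnit.neg_iff] at h
    have h1 : (U : Ell2 →L[ℂ] Ell2) + K
        = U * -(algebraMap ℂ (Ell2 →L[ℂ] Ell2) (-1) - V * K) := by
      rw [map_neg, map_one, neg_sub, sub_neg_eq_add, mul_add, mul_one, ← mul_assoc, hV,
        Units.mul_inv, one_mul, add_comm]
    rw [h1]
    exact U.isUnit.mul h

/-! ### Eigenvalues, the Fredholm alternative and square summable polynomials. -/

section Eigenvalues

variable {a b : ℕ → ℝ}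

theorem exists_bound_ofReal {w : ℕ → ℝ} {l : ℝ} (hw : Tendsto w atTop (𝓝 l)) :
    ∃ C : ℝ, ∀ n, ‖(w n : ℂ)‖ ≤ C :=
  exists_norm_bound_of_tendsto ((Complex.continuous_ofReal.tendsto _).comp hw)

theorem jacobiOp_sub_eq_free_add (ha_lim : Tendsto a atTop (𝓝 (1 / 2)))
    (hb_lim : Tendsto b atTop (𝓝 0)) (z : ℂ) :
    ∃ K : Ell2 →L[ℂ] Ell2, IsCompactOperator K ∧ jacobiOp a b - z • (1 : Ell2 →L[ℂ] Ell2)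
      = (jacobiOp (fun _ => 1 / 2) (fun _ => 0) - z • (1 : Ell2 →L[ℂ] Ell2)) + K := by
  refine ⟨jacobiOp (fun n => a n - 1 / 2) (fun n => b n - 0), isCompactOperator_jacobiOp ?_ ?_, ?_⟩
  · simpa using ha_lim.sub_const (1 / 2)
  · simpa using hb_lim
  · rw [← jacobiOp_sub (exists_bound_ofReal ha_lim) (exists_bound_ofReal hb_lim)
      (exists_bound_ofReal tendsto_const_nhds) (exists_bound_ofReal tendsto_const_nhds)]
    abel

theorem isEigenvalue_iff_exists {z : ℂ} :
    IsEigenvalue a b z ↔ ∃ x : Ell2, x ≠ 0 ∧ jacobiOp a b x = z • x := by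
  constructor
  · intro h
    obtain ⟨x, hx⟩ := Module.End.HasEigenvalue.exists_hasEigenvector h
    exact ⟨x, hx.2, hx.apply_eq_smul⟩
  · rintro ⟨x, hx0, hx⟩
    exact Module.End.hasEigenvalue_of_hasEigenvector
      (Module.End.hasEigenvector_iff.2 ⟨Module.End.mem_eigenspace_iff.2 hx, hx0⟩)

theorem isUnit_jacobiOp_sub (ha_lim : Tendsto a atTop (𝓝 (1 / 2)))
    (hb_lim : Tendsto b atTop (𝓝 0)) {z : ℂ} (hz : z ∉ cut) (hev : ¬ IsEigenvalue a b z) :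
    IsUnit (jacobiOp a b - z • (1 : Ell2 →L[ℂ] Ell2)) := by
  obtain ⟨K, hK, hJ⟩ := jacobiOp_sub_eq_free_add ha_lim hb_lim z
  have hinj : ∀ x, (jacobiOp a b - z • (1 : Ell2 →L[ℂ] Ell2)) x = 0 → x = 0 := by
    intro x hx
    by_contra hx0
    exact hev (isEigenvalue_iff_exists.2 ⟨x, hx0, sub_eq_zero.1 hx⟩)
  rw [hJ] at hinj ⊢
  exact isUnit_add_of_isCompactOperator (isUnit_free_sub hz) hK hinj

theorem IsEigenvalue.conj_eq (hb : ∃ C : ℝ, ∀ n, ‖(b n : ℂ)‖ ≤ C) {z : ℂ}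
    (hz : IsEigenvalue a b z) : conj z = z := by
  obtain ⟨x, hx0, hx⟩ := isEigenvalue_iff_exists.1 hz
  have hsa := ContinuousLinearMap.isSelfAdjoint_iff_isSymmetric.1 (isSelfAdjoint_jacobiOp a hb)
  have h1 : inner ℂ (jacobiOp a b x) x = inner ℂ x (jacobiOp a b x) := hsa x x
  rw [hx, inner_smul_left, inner_smul_right] at h1
  exact mul_right_cancel₀ (inner_self_ne_zero.2 hx0) h1

/-- The sequence `0, u_0, u_1, …`. -/
def consZero (u : ℕ → ℂ) : ℕ → ℂ
  | 0 => 0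
  | n + 1 => u n

theorem jacobiOp_apply (ha : ∃ C : ℝ, ∀ n, ‖(a n : ℂ)‖ ≤ C)
    (hb : ∃ C : ℝ, ∀ n, ‖(b n : ℂ)‖ ≤ C) (u : Ell2) (n : ℕ) :
    jacobiOp a b u n = aPrev a n * consZero u n + b n * u n + a n * u (n + 1) := by
  have ha' : ∃ C : ℝ, ∀ n, |a n| ≤ C := by simpa using ha
  have hb' : ∃ C : ℝ, ∀ n, |b n| ≤ C := by simpa using hb
  cases n with
  | zero => rw [jacobiOp_apply_zero ha' hb']; simp [consZero]
  | succ n => rw [jacobiOp_apply_succ ha' hb']; rfl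

theorem eq_smul_iff_solvesJacobi (ha : ∃ C : ℝ, ∀ n, ‖(a n : ℂ)‖ ≤ C)
    (hb : ∃ C : ℝ, ∀ n, ‖(b n : ℂ)‖ ≤ C) {z : ℂ} {u : Ell2} :
    jacobiOp a b u = z • u ↔ SolvesJacobi a b z (consZero u) := by
  rw [lp.ext_iff, funext_iff]
  refine forall_congr' fun n => ?_
  rw [jacobiOp_apply ha hb]
  rfl

theorem consZero_P (z : ℂ) : consZero (fun n => P a b n z) = polySeq a b z := by
  funext n
  cases n with
  | zero => rfl
  | succ n => rfl

/-- The first row forces `u_{-1} = 0`, so an eigenvector is determined by `u_0`. In particular every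
eigenvalue is simple. -/
theorem eq_mul_P_of_eigenvector (ha0 : ∀ n, 0 < a n) (ha : ∃ C : ℝ, ∀ n, ‖(a n : ℂ)‖ ≤ C)
    (hb : ∃ C : ℝ, ∀ n, ‖(b n : ℂ)‖ ≤ C) {z : ℂ} {u : Ell2} (hu : jacobiOp a b u = z • u) (n : ℕ) :
    u n = u 0 * P a b n z := by
  have h := (eq_smul_iff_solvesJacobi ha hb).1 hu
  exact congrFun (h.eq_of_init ha0 ((polySeq_solves ha0 z).const_mul (u 0))
    (by simp [consZero, polySeq]) (by simp [consZero, polySeq])) (n + 1)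

theorem isEigenvalue_iff_memℓp (ha0 : ∀ n, 0 < a n) (ha : ∃ C : ℝ, ∀ n, ‖(a n : ℂ)‖ ≤ C)
    (hb : ∃ C : ℝ, ∀ n, ‖(b n : ℂ)‖ ≤ C) {z : ℂ} :
    IsEigenvalue a b z ↔ Memℓp (fun n => P a b n z) 2 := by
  rw [isEigenvalue_iff_exists]
  constructor
  · rintro ⟨u, hu0, hu⟩
    have h := eq_mul_P_of_eigenvector ha0 ha hb hu
    have h0 : u 0 ≠ 0 := fun h0 => hu0 (by ext n; rw [h, h0, zero_mul]; rfl)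
    have h1 : (fun n => P a b n z) = (u 0)⁻¹ • (u : ℕ → ℂ) := by
      funext n
      rw [Pi.smul_apply, h n, smul_eq_mul, inv_mul_cancel_left₀ h0]
    rw [h1]
    exact (lp.memℓp u).const_smul _
  · intro h
    refine ⟨⟨_, h⟩, fun h0 => ?_, (eq_smul_iff_solvesJacobi ha hb).2 ?_⟩
    · have : P a b 0 z = 0 := congrFun (congrArg (fun u : Ell2 => (u : ℕ → ℂ)) h0) 0
      simp [P, polySeq] at this
    · have := polySeq_solves (b := b) ha0 z
      rwa [← consZero_P] at this

end Eigenvalues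

/-! ### The resolvent and its matrix elements -/

section Resolvent

variable {a b : ℕ → ℝ}

/-- Expand `u` in the basis and apply a continuous functional. No condition on `z` is needed,
because `R` is a bounded operator (zero in the default case). -/
theorem hasSum_entry (z : ℂ) (u : Ell2) (m : ℕ) :
    HasSum (fun n => entry a b n m z * u n) (R a b z u m) := by
  have h := lp.hasSum_single (p := 2) (by norm_num) u
  have h1 := h.mapL ((innerSL ℂ (e m)).comp (R a b z))
  have h2 : ∀ n, lp.single 2 n (u n) = u n • e n := fun n => by
    ext k
    by_cases hk : k = n
    · subst hk; simp [e]
    · simp [e, lp.single_apply, hk]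
  rw [ContinuousLinearMap.comp_apply, innerSL_apply_apply, inner_e] at h1
  have h3 : (fun n => entry a b n m z * u n)
      = fun n => ((innerSL ℂ (e m)).comp (R a b z)) (lp.single 2 n (u n)) := by
    funext n
    rw [h2, ContinuousLinearMap.comp_apply, map_smul, map_smul, innerSL_apply_apply, smul_eq_mul,
      mul_comm]
    rfl
  rw [h3]
  exact h1

/-- Stated for a general `T`, so that it serves both `J` and, at an eigenvalue, `J` plus the
eigenprojection. -/
theorem analyticAt_inverse_sub {T : Ell2 →L[ℂ] Ell2} {z : ℂ}
    (h : IsUnit (T - z • (1 : Ell2 →L[ℂ] Ell2))) (n m : ℕ) :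
    AnalyticAt ℂ (fun w =>
      inner ℂ (e m) (Ring.inverse (T - w • (1 : Ell2 →L[ℂ] Ell2)) (e n))) z := by
  obtain ⟨U, hU⟩ := h
  have h1 : AnalyticAt ℂ (fun w : ℂ => T - w • (1 : Ell2 →L[ℂ] Ell2)) z := by fun_prop
  have h2 : AnalyticAt ℂ (Ring.inverse : (Ell2 →L[ℂ] Ell2) → _)
      (T - z • (1 : Ell2 →L[ℂ] Ell2)) := by
    rw [← hU]
    exact analyticAt_inverse U
  have h3 : AnalyticAt ℂ (fun w : ℂ => Ring.inverse (T - w • (1 : Ell2 →L[ℂ] Ell2))) z :=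
    AnalyticAt.comp (g := Ring.inverse) (f := fun w : ℂ => T - w • (1 : Ell2 →L[ℂ] Ell2)) h2 h1
  let L : (Ell2 →L[ℂ] Ell2) →L[ℂ] ℂ :=
    (innerSL ℂ (e m)).comp (ContinuousLinearMap.apply ℂ Ell2 (e n))
  exact AnalyticAt.comp (g := L) (L.analyticAt _) h3

/-- The principal part of the resolvent at an eigenvalue outside `[-1, 1]`. -/
theorem exists_entry_eq_add_pole (ha0 : ∀ n, 0 < a n) (ha_lim : Tendsto a atTop (𝓝 (1 / 2)))
    (hb_lim : Tendsto b atTop (𝓝 0)) {z : ℂ} (hz : z ∉ cut) (hev : IsEigenvalue a b z) (n m : ℕ) :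
    ∃ (A : ℂ → ℂ) (κ : ℂ), AnalyticAt ℂ A z ∧ (κ ≠ 0 ↔ P a b n z * P a b m z ≠ 0) ∧
      ∀ᶠ w in 𝓝[≠] z, entry a b n m w = A w + (z - w)⁻¹ * κ := by
  have ha := exists_bound_ofReal ha_lim
  have hb := exists_bound_ofReal hb_lim
  obtain ⟨ψ, hψ0, hψ⟩ := isEigenvalue_iff_exists.1 hev
  have hψP := eq_mul_P_of_eigenvector ha0 ha hb hψ
  have hψ00 : ψ 0 ≠ 0 := fun h0 => hψ0 (by ext n; rw [hψP, h0, zero_mul]; rfl)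
  have hzr := hev.conj_eq hb
  have hsym := ContinuousLinearMap.isSelfAdjoint_iff_isSymmetric.1 (isSelfAdjoint_jacobiOp a hb)
  set J := jacobiOp a b with hJ
  set c : ℂ := (inner ℂ ψ ψ)⁻¹ with hc
  have hcψ : c * inner ℂ ψ ψ = 1 := inv_mul_cancel₀ (inner_self_ne_zero.2 hψ0)
  have hc0 : c ≠ 0 := left_ne_zero_of_mul_eq_one hcψ
  -- `π` is the orthogonal projection onto the eigenvector. `J + π` agrees with `J` on the
  -- orthogonal complement and has eigenvalue `z + 1` on `ψ`, so it no longer has the eigenvalue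
  -- `z`.
  obtain ⟨π, hπ⟩ : ∃ π : Ell2 →L[ℂ] Ell2, π = c • (innerSL ℂ ψ).smulRight ψ := ⟨_, rfl⟩
  have hπapply : ∀ u, π u = (c * inner ℂ ψ u) • ψ := fun u => by
    simp [hπ, smul_smul]
  have hJψ : ∀ u, inner ℂ ψ (J u) = z * inner ℂ ψ u := fun u => by
    have h1 : inner ℂ (J ψ) u = inner ℂ ψ (J u) := hsym ψ u
    rw [← h1, hψ, inner_smul_left, hzr]
  have hunit : IsUnit ((J + π) - z • (1 : Ell2 →L[ℂ] Ell2)) := by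
    obtain ⟨K, hK, hJK⟩ := jacobiOp_sub_eq_free_add ha_lim hb_lim z
    have hπc : IsCompactOperator (K + π) :=
      hπ ▸ hK.add ((isCompactOperator_smulRight ψ ψ).smul c)
    have h1 : (J + π) - z • (1 : Ell2 →L[ℂ] Ell2)
        = (jacobiOp (fun _ => 1 / 2) (fun _ => 0) - z • (1 : Ell2 →L[ℂ] Ell2)) + (K + π) := by
      rw [← add_assoc, ← hJK]; abel
    rw [h1]
    refine isUnit_add_of_isCompactOperator (isUnit_free_sub hz) hπc fun x hx => ?_
    rw [← add_apply, ← h1] at hx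
    have hx' : J x + π x - z • x = 0 := hx
    have h2 : inner ℂ ψ x = 0 := by
      have := congrArg (inner ℂ ψ) hx'
      rw [inner_sub_right, inner_add_right, hJψ, inner_smul_right, hπapply, inner_smul_right,
        inner_zero_right] at this
      linear_combination this - inner ℂ ψ x * hcψ
    have h3 : J x = z • x := by
      rw [hπapply, h2, mul_zero, zero_smul, add_zero] at hx'
      exact sub_eq_zero.1 hx'
    -- Simplicity of the eigenvalue: a kernel vector is both orthogonal to `ψ` and a multiple of it.
    have h4 : x = (x 0 / ψ 0) • ψ := by
      ext k
      rw [lp.coeFn_smul, Pi.smul_apply, smul_eq_mul, hψP k,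
        eq_mul_P_of_eigenvector ha0 ha hb h3 k]
      field_simp
    rw [h4, inner_smul_right] at h2
    rw [h4, (mul_eq_zero.1 h2).resolve_right (inner_self_ne_zero.2 hψ0), zero_smul]
  set κ : ℂ := inner ℂ (e m) (π (e n)) with hκ
  have hκeq : κ = c * conj (ψ 0 * P a b n z) * (ψ 0 * P a b m z) := by
    rw [hκ, hπapply, inner_smul_right, inner_e, ← hψP, ← hψP, ← inner_conj_symm, inner_e]
  let B : ℂ → Ell2 →L[ℂ] Ell2 := fun w => Ring.inverse ((J + π) - w • (1 : Ell2 →L[ℂ] Ell2))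
  refine ⟨fun w => inner ℂ (e m) (B w (e n)) - (1 + z - w)⁻¹ * κ, κ, ?_, ?_, ?_⟩
  · refine (analyticAt_inverse_sub hunit n m).sub (AnalyticAt.mul ?_ analyticAt_const)
    refine AnalyticAt.inv (by fun_prop) (by simp)
  · rw [hκeq]
    simp [hc0, hψ00]
  · have h1 : ∀ᶠ w in 𝓝 z, IsUnit ((J + π) - w • (1 : Ell2 →L[ℂ] Ell2)) := by
      have hcont : Continuous fun w : ℂ => (J + π) - w • (1 : Ell2 →L[ℂ] Ell2) := by fun_prop
      exact hcont.continuousAt.eventually_mem (Units.isOpen.mem_nhds hunit)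
    have h2 : ∀ᶠ w in 𝓝 z, 1 + z - w ≠ 0 := by
      have hcont : Continuous fun w : ℂ => 1 + z - w := by fun_prop
      exact hcont.continuousAt.eventually_ne (by simp)
    filter_upwards [nhdsWithin_le_nhds h1, nhdsWithin_le_nhds h2, self_mem_nhdsWithin]
      with w hw1 hw2 hw3
    have hw3' : z - w ≠ 0 := sub_ne_zero.2 (Ne.symm hw3)
    set T := (J + π) - w • (1 : Ell2 →L[ℂ] Ell2) with hT
    have hTB : T * B w = 1 := Ring.mul_inverse_cancel _ hw1
    have hBT : B w * T = 1 := Ring.inverse_mul_cancel _ hw1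
    have hππ : π * π = π := by
      refine ContinuousLinearMap.ext fun u => ?_
      rw [mul_apply_eq_comp, hπapply (π u), hπapply u, inner_smul_right]
      congr 1
      linear_combination (c * inner ℂ ψ u) * hcψ
    have hJπ : J * π = z • π := by
      refine ContinuousLinearMap.ext fun u => ?_
      rw [mul_apply_eq_comp, smul_apply, hπapply u, map_smul, hψ, smul_comm]
    have hπJ : π * J = z • π := by
      refine ContinuousLinearMap.ext fun u => ?_
      rw [mul_apply_eq_comp, smul_apply, hπapply, hπapply u, hJψ, smul_smul]
      congr 1; ring
    have hTπ : T * π = (1 + z - w) • π := by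
      rw [hT, sub_mul, add_mul, hJπ, hππ, smul_mul_assoc, one_mul]
      module
    have hπT : π * T = (1 + z - w) • π := by
      rw [hT, mul_sub, mul_add, hπJ, hππ, mul_smul_comm, mul_one]
      module
    have hBπ : B w * π = (1 + z - w)⁻¹ • π := by
      have : B w * (T * π) = π := by rw [← mul_assoc, hBT, one_mul]
      rw [hTπ, mul_smul_comm] at this
      rw [eq_inv_smul_iff₀ hw2, this]
    have hπB : π * B w = (1 + z - w)⁻¹ • π := by
      have : (π * T) * B w = π := by rw [mul_assoc, hTB, mul_one]
      rw [hπT, smul_mul_assoc] at this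
      rw [eq_inv_smul_iff₀ hw2, this]
    have hJw : J - w • (1 : Ell2 →L[ℂ] Ell2) = T - π := by rw [hT]; abel
    -- On the range of `π` the resolvent of `J` is `(z - w)⁻¹` and that of `J + π` is `(1 + z -
    -- w)⁻¹`; elsewhere they agree. Their difference is therefore `t • π`.
    set t : ℂ := (z - w)⁻¹ - (1 + z - w)⁻¹ with ht
    have hcoef : -(1 + z - w)⁻¹ + (t * (1 + z - w) - t) = 0 := by
      rw [ht]; field_simp; ring
    have e1 : (J - w • (1 : Ell2 →L[ℂ] Ell2)) * (B w + t • π) = 1 := by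
      rw [hJw, sub_mul, mul_add, mul_add, hTB, hπB, mul_smul_comm, mul_smul_comm, hTπ, hππ]
      have : (1 : Ell2 →L[ℂ] Ell2) + t • (1 + z - w) • π - ((1 + z - w)⁻¹ • π + t • π)
          = 1 + (-(1 + z - w)⁻¹ + (t * (1 + z - w) - t)) • π := by module
      rw [this, hcoef, zero_smul, add_zero]
    have e2 : (B w + t • π) * (J - w • (1 : Ell2 →L[ℂ] Ell2)) = 1 := by
      rw [hJw, mul_sub, add_mul, add_mul, hBT, hBπ, smul_mul_assoc, smul_mul_assoc, hπT, hππ]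
      have : (1 : Ell2 →L[ℂ] Ell2) + t • (1 + z - w) • π - ((1 + z - w)⁻¹ • π + t • π)
          = 1 + (-(1 + z - w)⁻¹ + (t * (1 + z - w) - t)) • π := by module
      rw [this, hcoef, zero_smul, add_zero]
    have hR : R a b w = B w + t • π :=
      Ring.inverse_unit ⟨J - w • (1 : Ell2 →L[ℂ] Ell2), B w + t • π, e1, e2⟩
    rw [entry, hR, add_apply, smul_apply, inner_add_right, inner_smul_right]
    simp only [ht]
    ring

theorem meromorphicOrderAt_add_pole {g A : ℂ → ℂ} {z κ : ℂ} (hA : AnalyticAt ℂ A z)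
    (hg : ∀ᶠ w in 𝓝[≠] z, g w = A w + (z - w)⁻¹ * κ) :
    MeromorphicAt g z ∧ ((-1 : ℤ) : WithTop ℤ) ≤ meromorphicOrderAt g z ∧
      (meromorphicOrderAt g z = ((-1 : ℤ) : WithTop ℤ) ↔ κ ≠ 0) := by
  have hmer : MeromorphicAt g z := by
    have h1 : MeromorphicAt (fun w => A w + (z - w)⁻¹ * κ) z := by
      have := hA.meromorphicAt
      fun_prop
    exact h1.congr (hg.mono fun w hw => hw.symm)
  refine ⟨hmer, ?_⟩
  by_cases hκ : κ = 0
  · have h1 : g =ᶠ[𝓝[≠] z] A := hg.mono fun w hw => by rw [hw, hκ, mul_zero, add_zero]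
    have h0 : (0 : WithTop ℤ) ≤ meromorphicOrderAt g z := by
      rw [meromorphicOrderAt_congr h1]
      exact hA.meromorphicOrderAt_nonneg
    have h2 : ((-1 : ℤ) : WithTop ℤ) < 0 := by
      exact_mod_cast (by norm_num : (-1 : ℤ) < 0)
    exact ⟨h2.le.trans h0, fun h => absurd h (h2.trans_le h0).ne', fun h => absurd hκ h⟩
  · have h1 : meromorphicOrderAt g z = ((-1 : ℤ) : WithTop ℤ) := by
      rw [meromorphicOrderAt_eq_int_iff hmer]
      -- This is `(w - z) g(w)`, continued analytically to `z`, where its value is `-κ ≠ 0`.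
      refine ⟨fun w => (w - z) * A w - κ, by fun_prop, by simpa using hκ, ?_⟩
      filter_upwards [hg, self_mem_nhdsWithin] with w hw hne
      have h2 : w - z ≠ 0 := sub_ne_zero.2 hne
      have h3 : (z - w)⁻¹ = -(w - z)⁻¹ := by rw [← inv_neg, neg_sub]
      rw [hw, h3, zpow_neg_one, smul_eq_mul]
      field_simp
      ring
    exact ⟨h1.ge, fun _ => hκ, fun _ => h1⟩

/-- The matrix elements of the resolvent in terms of a solution in `ℓ²`. -/
theorem entry_eq_of_solution (ha0 : ∀ n, 0 < a n) (ha : ∃ C : ℝ, ∀ n, ‖(a n : ℂ)‖ ≤ C)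
    (hb : ∃ C : ℝ, ∀ n, ‖(b n : ℂ)‖ ≤ C) {z : ℂ}
    (hunit : IsUnit (jacobiOp a b - z • (1 : Ell2 →L[ℂ] Ell2))) {F : ℕ → ℂ}
    (hF : SolvesJacobi a b z F) (hF2 : Memℓp (fun n => F (n + 1)) 2)
    (hW : wronskian a (polySeq a b z) F 0 ≠ 0) (n m : ℕ) :
    entry a b n m z
      = (wronskian a (polySeq a b z) F 0)⁻¹ * P a b (min n m) z * F (max n m + 1) := by
  set W := wronskian a (polySeq a b z) F 0 with hWdef
  have hP := polySeq_solves (b := b) ha0 z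
  have hWn : ∀ k, wronskian a (polySeq a b z) F k = W := wronskian_eq hP hF
  set p := polySeq a b z with hp
  let g : ℕ → ℂ := fun k => W⁻¹ * P a b (min n k) z * F (max n k + 1)
  have hg : Memℓp g 2 := by
    have h1 : Memℓp (fun k => W⁻¹ * p (n + 1) * F (k + 1)) 2 := hF2.const_mul _
    have h2 : ∀ᶠ k in cofinite, (fun k => W⁻¹ * p (n + 1) * F (k + 1)) k = g k := by
      rw [Nat.cofinite_eq_atTop]
      filter_upwards [eventually_ge_atTop n] with k hk
      simp only [g, P, min_eq_left hk, max_eq_right hk]; rfl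
    rw [memℓp_gen_iff (by norm_num)] at h1 ⊢
    exact (summable_congr_cofinite (h2.mono fun k hk => by rw [← hk])).1 h1
  let G : Ell2 := ⟨g, hg⟩
  have hG : ∀ k, consZero G k = if k ≤ n + 1 then W⁻¹ * p k * F (n + 1)
      else W⁻¹ * p (n + 1) * F k := by
    intro k
    cases k with
    | zero => simp [consZero, hp, polySeq]
    | succ k =>
      change W⁻¹ * p (min n k + 1) * F (max n k + 1) = _
      rcases le_or_gt k n with h | h
      · rw [if_pos (by omega), min_eq_right h, max_eq_left h]
      · rw [if_neg (by omega), min_eq_left h.le, max_eq_right h.le]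
  have hJG : (jacobiOp a b - z • (1 : Ell2 →L[ℂ] Ell2)) G = e n := by
    ext k
    have h1 : (jacobiOp a b - z • (1 : Ell2 →L[ℂ] Ell2)) G k = jacobiOp a b G k - z * G k := rfl
    rw [h1, jacobiOp_apply ha hb, e_apply]
    change aPrev a k * consZero G k + b k * consZero G (k + 1) + a k * consZero G (k + 2)
      - z * consZero G (k + 1) = _
    rw [hG, hG, hG]
    have eP := hP k
    have eF := hF k
    rcases lt_trichotomy k n with h | h | h
    · rw [if_pos (by omega), if_pos (by omega), if_pos (by omega), if_neg (by omega)]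
      linear_combination W⁻¹ * F (n + 1) * eP
    · subst h
      rw [if_pos (by omega), if_pos (by omega), if_neg (by omega), if_pos rfl]
      -- In the diagonal row `G` switches from a multiple of `P` to a multiple of `F`; the defect is
      -- the Wronskian, normalized to `1` by `W⁻¹`.
      have hw := hWn (k + 1)
      simp only [wronskian, aPrev] at hw
      have hWi : W⁻¹ * W = 1 := inv_mul_cancel₀ hW
      linear_combination W⁻¹ * F (k + 1) * eP + W⁻¹ * hw + hWi
    · rcases (show k = n + 1 ∨ n + 1 < k by omega) with h' | h'
      · subst h'
        rw [if_pos le_rfl, if_neg (by omega), if_neg (by omega), if_neg (by omega)]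
        linear_combination W⁻¹ * p (n + 1) * eF
      · rw [if_neg (by omega), if_neg (by omega), if_neg (by omega), if_neg (by omega)]
        linear_combination W⁻¹ * p (n + 1) * eF
  have hR : R a b z (e n) = G := by
    rw [← hJG, R, ← mul_apply_eq_comp, Ring.inverse_mul_cancel _ hunit, one_apply_eq_self]
  rw [entry, hR, inner_e]

end Resolvent

/-! ### Regular points -/

section Regular

variable {a b : ℕ → ℝ} {s : Side}

theorem openHalf_subset_closedHalf (s : Side) : s.openHalf ⊆ s.closedHalf := by
  cases s
  · exact fun z (hz : 0 < z.im) => hz.le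
  · exact fun z (hz : z.im < 0) => hz.le

theorem im_ne_zero_of_mem_openHalf {z : ℂ} (hz : z ∈ s.openHalf) : z.im ≠ 0 := by
  cases s
  · exact (show 0 < z.im from hz).ne'
  · exact (show z.im < 0 from hz).ne

theorem notMem_cut_of_im_ne_zero {z : ℂ} (hz : z.im ≠ 0) : z ∉ cut := by
  rintro ⟨x, -, rfl⟩
  exact hz (Complex.ofReal_im x)

/-- Needed for the limits defining `edgeEntry` to be unique. -/
theorem nhdsWithin_openHalf_neBot (s : Side) (x : ℝ) : (𝓝[s.openHalf] (x : ℂ)).NeBot := by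
  obtain ⟨σ, hσ⟩ : ∃ σ : ℝ, ∀ t : ℝ, 0 < t → (x + σ * t * Complex.I : ℂ) ∈ s.openHalf := by
    cases s
    · exact ⟨1, fun t ht => by simpa [Side.openHalf] using ht⟩
    · exact ⟨-1, fun t ht => by simpa [Side.openHalf] using ht⟩
  have h1 : Tendsto (fun t : ℝ => (x + σ * t * Complex.I : ℂ)) (𝓝[>] 0)
      (𝓝[s.openHalf] (x : ℂ)) := by
    refine tendsto_nhdsWithin_iff.2 ⟨?_, ?_⟩
    · have hc : Continuous fun t : ℝ => (x + σ * t * Complex.I : ℂ) := by fun_prop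
      have := hc.tendsto 0
      simp only [Complex.ofReal_zero, mul_zero, zero_mul, add_zero] at this
      exact this.mono_left nhdsWithin_le_nhds
    · filter_upwards [self_mem_nhdsWithin] with t ht using hσ t ht
  exact h1.neBot

theorem ne_one_of_notMem_cut {z : ℂ} (hz : z ∉ cut) : z ≠ 1 ∧ z ≠ -1 :=
  ⟨fun h => hz (h ▸ one_mem_cut), fun h => hz (h ▸ neg_one_mem_cut)⟩

/-- Outside `[-1, 1]` the eigenvalues are the zeros of `Ω`. -/
theorem isEigenvalue_iff_Omega_eq_zero (ha : ∀ n, 0 < a n)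
    (ha_lim : Tendsto a atTop (𝓝 (1 / 2))) (hb_lim : Tendsto b atTop (𝓝 0))
    (h_var : Summable fun n => |a (n + 1) - a n| + |b (n + 1) - b n|)
    {z : ℂ} (hz : z ∈ s.closedHalf) (hc : z ∉ cut) : IsEigenvalue a b z ↔ Omega a b s z = 0 := by
  have hab := exists_bound_ofReal ha_lim
  have hbb := exists_bound_ofReal hb_lim
  obtain ⟨h1, h2⟩ := ne_one_of_notMem_cut hc
  have hF := isJostSolution_jostSeq ha ha_lim hb_lim h_var hz h1 h2
  have hF2 := memℓp_jostSeq ha ha_lim hb_lim hz hc hF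
  have hP := polySeq_solves (b := b) ha z
  rw [isEigenvalue_iff_memℓp ha hab hbb]
  constructor
  · intro hP2
    -- If `P` and `f` are both square summable, they tend to zero, and so does their constant
    -- Wronskian. Conversely a vanishing Wronskian makes `P` a multiple of the square summable `f`.
    have tend : ∀ {u : ℕ → ℂ}, Memℓp u 2 → Tendsto u atTop (𝓝 0) := fun {u} hu => by
      have h3 : Summable fun n => ‖u n‖ ^ 2 := by
        have := hu.summable (by norm_num)
        simpa using this
      rw [tendsto_zero_iff_norm_tendsto_zero]
      simpa using h3.tendsto_atTop_zero.sqrt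
    have t1 := tend hP2
    have t2 := tend hF2
    have ta : Tendsto (fun n => (a n : ℂ)) atTop (𝓝 ((1 / 2 : ℝ) : ℂ)) :=
      (Complex.continuous_ofReal.tendsto _).comp ha_lim
    have hlim : Tendsto (fun n => wronskian a (polySeq a b z) (jostSeq a b s z) (n + 1)) atTop
        (𝓝 0) := by
      have := ta.mul ((t1.mul ((tendsto_add_atTop_iff_nat 1).2 t2)).sub
        (((tendsto_add_atTop_iff_nat 1).2 t1).mul t2))
      simp only [mul_zero, sub_zero] at this
      exact this
    simp only [wronskian_eq hP hF.1] at hlim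
    exact tendsto_nhds_unique tendsto_const_nhds hlim
  · intro h0
    obtain ⟨c, hc⟩ := hP.exists_eq_mul ha hF.1 (polySeq_ne_zero a b z) h0
    have hc0 : c ≠ 0 := by
      rintro rfl
      exact hF.ne_zero (funext fun n => by rw [hc, zero_mul]; rfl)
    have h3 : (fun n => P a b n z) = fun n => c⁻¹ * jostSeq a b s z (n + 1) := by
      funext n
      rw [hc, inv_mul_cancel_left₀ hc0]
      rfl
    rw [h3]
    exact hF2.const_mul _

theorem mem_Ioo_of_mem_cut {z : ℂ} (hz : z ∈ cut) (h1 : z ≠ 1) (h2 : z ≠ -1) :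
    ∃ x ∈ Ioo (-1 : ℝ) 1, (x : ℂ) = z := by
  obtain ⟨x, hx, rfl⟩ := hz
  refine ⟨x, ⟨lt_of_le_of_ne hx.1 ?_, lt_of_le_of_ne hx.2 ?_⟩, rfl⟩
  · rintro rfl; simp at h2
  · rintro rfl; simp at h1

theorem Omega_ne_zero_of_mem_regularSet (ha : ∀ n, 0 < a n)
    (ha_lim : Tendsto a atTop (𝓝 (1 / 2))) (hb_lim : Tendsto b atTop (𝓝 0))
    (h_var : Summable fun n => |a (n + 1) - a n| + |b (n + 1) - b n|)
    {z : ℂ} (hz : z ∈ regularSet a b s) : Omega a b s z ≠ 0 := by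
  obtain ⟨hzs, h1, h2, hreg⟩ := hz
  by_cases hc : z ∈ cut
  · obtain ⟨x, hx, rfl⟩ := mem_Ioo_of_mem_cut hc h1 h2
    exact Omega_ne_zero_of_mem_Ioo ha ha_lim hb_lim h_var hx
  · rw [Ne, ← isEigenvalue_iff_Omega_eq_zero ha ha_lim hb_lim h_var hzs hc]
    exact hreg hc

theorem regularSet_subset (a b : ℕ → ℝ) (s : Side) :
    regularSet a b s ⊆ s.closedHalf \ {1, -1} := fun z hz =>
  ⟨hz.1, by simp [hz.2.1, hz.2.2.1]⟩

theorem continuousOn_greenFunction (ha : ∀ n, 0 < a n)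
    (ha_lim : Tendsto a atTop (𝓝 (1 / 2))) (hb_lim : Tendsto b atTop (𝓝 0))
    (h_var : Summable fun n => |a (n + 1) - a n| + |b (n + 1) - b n|) (n m : ℕ) :
    ContinuousOn (fun z => (Omega a b s z)⁻¹ * P a b n z * f a b s m z) (regularSet a b s) := by
  refine ContinuousOn.mul (ContinuousOn.mul (ContinuousOn.inv₀ ?_ ?_) ?_) ?_
  · exact (continuousOn_Omega ha ha_lim hb_lim h_var).mono (regularSet_subset a b s)
  · exact fun z hz => Omega_ne_zero_of_mem_regularSet ha ha_lim hb_lim h_var hz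
  · exact (continuous_polySeq a b (n + 1)).continuousOn
  · exact (continuousOn_jostSeq ha ha_lim hb_lim h_var (m + 1)).mono (regularSet_subset a b s)

theorem entry_eq_greenFunction (ha : ∀ n, 0 < a n)
    (ha_lim : Tendsto a atTop (𝓝 (1 / 2))) (hb_lim : Tendsto b atTop (𝓝 0))
    (h_var : Summable fun n => |a (n + 1) - a n| + |b (n + 1) - b n|)
    {z : ℂ} (hz : z ∈ regularSet a b s) (hc : z ∉ cut) (n m : ℕ) :
    entry a b n m z = (Omega a b s z)⁻¹ * P a b (min n m) z * f a b s (max n m) z := by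
  have hF := isJostSolution_jostSeq ha ha_lim hb_lim h_var hz.1 hz.2.1 hz.2.2.1
  exact entry_eq_of_solution ha (exists_bound_ofReal ha_lim) (exists_bound_ofReal hb_lim)
    (isUnit_jacobiOp_sub ha_lim hb_lim hc (hz.2.2.2 hc)) hF.1
    (memℓp_jostSeq ha ha_lim hb_lim hz.1 hc hF)
    (Omega_ne_zero_of_mem_regularSet ha ha_lim hb_lim h_var hz) n m

/-- Eigenvalues of the self-adjoint operator `J` are real. -/
theorem openHalf_subset_regularSet (hb_lim : Tendsto b atTop (𝓝 0)) :
    s.openHalf ⊆ regularSet a b s := by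
  intro z hz
  have him := im_ne_zero_of_mem_openHalf hz
  obtain ⟨h1, h2⟩ := ne_one_of_notMem_cut (notMem_cut_of_im_ne_zero him)
  refine ⟨openHalf_subset_closedHalf s hz, h1, h2, fun _ hev => him ?_⟩
  exact Complex.conj_eq_iff_im.1 (hev.conj_eq (exists_bound_ofReal hb_lim))

/-- The Green function is continuous up to the edge and equals the matrix element in the open
half-plane, so its value at the edge is the limit there. -/
theorem edgeEntry_eq_greenFunction (ha : ∀ n, 0 < a n)
    (ha_lim : Tendsto a atTop (𝓝 (1 / 2))) (hb_lim : Tendsto b atTop (𝓝 0))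
    (h_var : Summable fun n => |a (n + 1) - a n| + |b (n + 1) - b n|)
    {z : ℂ} (hz : z ∈ regularSet a b s) (n m : ℕ) :
    edgeEntry a b s n m z = (Omega a b s z)⁻¹ * P a b (min n m) z * f a b s (max n m) z := by
  by_cases hc : z ∈ cut
  · rw [edgeEntry, if_pos hc]
    have hne : (𝓝[s.openHalf] z).NeBot := by
      obtain ⟨x, -, rfl⟩ := hc
      exact nhdsWithin_openHalf_neBot s x
    have hsub : s.openHalf ⊆ regularSet a b s := openHalf_subset_regularSet hb_lim
    refine Tendsto.limUnder_eq ?_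
    have h1 := (continuousOn_greenFunction (s := s) ha ha_lim hb_lim h_var (min n m) (max n m) z
      hz).tendsto.mono_left (nhdsWithin_mono z hsub)
    refine h1.congr' ?_
    filter_upwards [self_mem_nhdsWithin] with w hw
    exact (entry_eq_greenFunction ha ha_lim hb_lim h_var (hsub hw)
      (notMem_cut_of_im_ne_zero (im_ne_zero_of_mem_openHalf hw)) n m).symm
  · rw [edgeEntry, if_neg hc]
    exact entry_eq_greenFunction ha ha_lim hb_lim h_var hz hc n m

theorem exists_edgeEntry_bounds (ha : ∀ n, 0 < a n)
    (ha_lim : Tendsto a atTop (𝓝 (1 / 2))) (hb_lim : Tendsto b atTop (𝓝 0))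
    (h_var : Summable fun n => |a (n + 1) - a n| + |b (n + 1) - b n|)
    {K : Set ℂ} (hK : IsCompact K) (hKs : K ⊆ s.closedHalf) (h1 : (1 : ℂ) ∉ K)
    (h2 : (-1 : ℂ) ∉ K) :
    ∃ C : ℝ, 0 < C ∧
      (∀ z ∈ K, z ∈ regularSet a b s → ∀ n m : ℕ, n ≤ m →
        ‖edgeEntry a b s n m z‖ ≤ C * ‖Omega a b s z‖⁻¹ * ‖q a b s m z / q a b s n z‖) ∧
      (K ⊆ regularSet a b s → ∃ C₁ : ℝ, 0 < C₁ ∧ ∀ z ∈ K, ∀ n m : ℕ, n ≤ m →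
        C * ‖Omega a b s z‖⁻¹ * ‖q a b s m z / q a b s n z‖ ≤ C₁) := by
  obtain ⟨F, hF, ⟨CF, hCF⟩, CP, hCP⟩ := exists_jost_family ha ha_lim hb_lim h_var hK hKs h1 h2
  -- The constants bound `f_m / q_m` and `P_n q_n` on `K`; adding `1` only ensures positivity.
  refine ⟨|CF| * |CP| + 1, by positivity, fun z hz hreg n m hnm => ?_, fun hreg => ?_⟩
  · rw [edgeEntry_eq_greenFunction ha ha_lim hb_lim h_var hreg, min_eq_left hnm, max_eq_right hnm]
    have e1 : ‖f a b s m z / q a b s m z‖ ≤ |CF| := by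
      have h3 := (hCF m ⟨z, hz⟩).trans (le_abs_self _)
      rwa [← congrFun ((hF ⟨z, hz⟩).jostSeq_eq ha ha_lim (hKs hz)) (m + 1)] at h3
    have e2 : ‖P a b n z * q a b s n z‖ ≤ |CP| := (hCP n ⟨z, hz⟩).trans (le_abs_self _)
    have e3 : (Omega a b s z)⁻¹ * P a b n z * f a b s m z
        = (f a b s m z / q a b s m z) * (P a b n z * q a b s n z) * (Omega a b s z)⁻¹
          * (q a b s m z / q a b s n z) := by
      have := q_ne_zero a b s m z
      have := q_ne_zero a b s n z
      field_simp
    rw [e3, norm_mul, norm_mul, norm_mul, norm_inv]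
    gcongr
    calc ‖f a b s m z / q a b s m z‖ * ‖P a b n z * q a b s n z‖ ≤ |CF| * |CP| := by gcongr
      _ ≤ |CF| * |CP| + 1 := by linarith
  · obtain ⟨E, hE⟩ := hK.exists_bound_of_continuousOn
      (((continuousOn_Omega ha ha_lim hb_lim h_var).mono
        (hreg.trans (regularSet_subset a b s))).inv₀ fun z hz =>
          Omega_ne_zero_of_mem_regularSet ha ha_lim hb_lim h_var (hreg hz))
    refine ⟨(|CF| * |CP| + 1) * (|E| + 1), by positivity, fun z hz n m hnm => ?_⟩
    have e1 : ‖Omega a b s z‖⁻¹ ≤ |E| + 1 := by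
      have h3 := hE z hz
      rw [Pi.inv_apply, norm_inv] at h3
      linarith [le_abs_self E]
    -- `|q_n|` is nonincreasing since each factor `ζ` has modulus at most `1`.
    have e2 : ‖q a b s m z / q a b s n z‖ ≤ 1 := by
      rw [norm_div]
      exact div_le_one_of_le₀ (norm_q_antitone ha (hKs hz) hnm) (norm_nonneg _)
    refine (mul_le_of_le_one_right (by positivity) e2).trans ?_
    gcongr

end Regular

end LongRangeJacobi

/-! ### Assembly of the theorem. -/

open LongRangeJacobi in
theorem theorem5p3 (a b : ℕ → ℝ) (ha : ∀ n, 0 < a n)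
    (ha_lim : Tendsto (fun n => a n - 1 / 2) atTop (𝓝 0)) (hb_lim : Tendsto b atTop (𝓝 0))
    (h_var : Summable fun n => |a (n + 1) - a n| + |b (n + 1) - b n|) :
    -- the Jost solutions are well defined
    (∀ s : Side, ∀ z ∈ s.closedHalf, z ≠ 1 → z ≠ -1 → ∃! F : ℕ → ℂ, IsJostSolution a b s z F) ∧
    -- (i) the resolvent exists outside `[-1, 1]` and the eigenvalues, and it is given by its
    -- matrix elements
    (∀ z : ℂ, z ∉ cut → ¬ IsEigenvalue a b z →
      IsUnit (jacobiOp a b - z • (1 : Ell2 →L[ℂ] Ell2)) ∧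
      ∀ (u : Ell2) (m : ℕ), HasSum (fun n => entry a b n m z * u n) (R a b z u m)) ∧
    -- the formula for the matrix elements, also on the edges of the cut `(-1, 1)`
    (∀ s : Side, ∀ z ∈ regularSet a b s, Omega a b s z ≠ 0 ∧
      ∀ n m : ℕ, n ≤ m →
        edgeEntry a b s n m z = (Omega a b s z)⁻¹ * P a b n z * f a b s m z ∧
        edgeEntry a b s m n z = edgeEntry a b s n m z) ∧
    -- analyticity
    (∀ n m : ℕ, AnalyticOnNhd ℂ (entry a b n m) {z | z ∉ cut ∧ ¬ IsEigenvalue a b z}) ∧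
    -- the singularities at eigenvalues are at most simple poles; the pole is there unless the
    -- residue of the matrix element vanishes, and always for `n = m = 0`
    (∀ z : ℂ, z ∉ cut → IsEigenvalue a b z → ∀ n m : ℕ,
      MeromorphicAt (entry a b n m) z ∧
      ((-1 : ℤ) : WithTop ℤ) ≤ meromorphicOrderAt (entry a b n m) z ∧
      (meromorphicOrderAt (entry a b n m) z = ((-1 : ℤ) : WithTop ℤ) ↔
        P a b n z * P a b m z ≠ 0)) ∧
    -- the eigenvalues outside `[-1, 1]` are the zeros of `Ω`
    (∀ s : Side, ∀ z ∈ s.closedHalf, z ∉ cut → (IsEigenvalue a b z ↔ Omega a b s z = 0)) ∧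
    -- (ii) limiting absorption principle
    (∀ (s : Side) (n m : ℕ), ContinuousOn (edgeEntry a b s n m) (regularSet a b s)) ∧
    -- (iii) uniform bounds
    (∀ (s : Side) (K : Set ℂ), IsCompact K → K ⊆ s.closedHalf → 1 ∉ K → -1 ∉ K →
      ∃ C : ℝ, 0 < C ∧
        (∀ z ∈ K, z ∈ regularSet a b s → ∀ n m : ℕ, n ≤ m →
          ‖edgeEntry a b s n m z‖ ≤ C * ‖Omega a b s z‖⁻¹ * ‖q a b s m z / q a b s n z‖) ∧
        (K ⊆ regularSet a b s → ∃ C₁ : ℝ, 0 < C₁ ∧ ∀ z ∈ K, ∀ n m : ℕ, n ≤ m →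
          C * ‖Omega a b s z‖⁻¹ * ‖q a b s m z / q a b s n z‖ ≤ C₁)) := by
  have ha_lim' : Tendsto a atTop (𝓝 (1 / 2)) := by
    have h := ha_lim.add_const (1 / 2)
    simp only [sub_add_cancel, zero_add] at h
    exact h
  refine ⟨fun s z hz h1 h2 => existsUnique_jost ha ha_lim' hb_lim h_var hz h1 h2,
    fun z hz hev => ⟨isUnit_jacobiOp_sub ha_lim' hb_lim hz hev, hasSum_entry z⟩,
    fun s z hz => ⟨Omega_ne_zero_of_mem_regularSet ha ha_lim' hb_lim h_var hz,
      fun n m hnm => ⟨?_, ?_⟩⟩,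
    fun n m z hz => analyticAt_inverse_sub (isUnit_jacobiOp_sub ha_lim' hb_lim hz.1 hz.2) n m,
    fun z hz hev n m => ?_,
    fun s z hz hc => isEigenvalue_iff_Omega_eq_zero ha ha_lim' hb_lim h_var hz hc,
    fun s n m => ?_,
    fun s K hK hKs h1 h2 => exists_edgeEntry_bounds ha ha_lim' hb_lim h_var hK hKs h1 h2⟩
  · rw [edgeEntry_eq_greenFunction ha ha_lim' hb_lim h_var hz, min_eq_left hnm, max_eq_right hnm]
  · rw [edgeEntry_eq_greenFunction ha ha_lim' hb_lim h_var hz,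
      edgeEntry_eq_greenFunction ha ha_lim' hb_lim h_var hz, min_comm, max_comm]
  · obtain ⟨A, κ, hA, hκ, hentry⟩ := exists_entry_eq_add_pole ha ha_lim' hb_lim hz hev n m
    rw [← hκ]
    exact meromorphicOrderAt_add_pole hA hentry
  · exact (continuousOn_greenFunction ha ha_lim' hb_lim h_var (min n m) (max n m)).congr
      fun z hz => edgeEntry_eq_greenFunction ha ha_lim' hb_lim h_var hz n m
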